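/- We work in the deterministic $\mathsf{LOCAL}$ model. The network is a finite simple graph $G=(V,E)$ with $n=|V|$ nodes and maximum degree $\Delta$, whose edges $e$ carry real weights $w_e\ge 0$. Nodes have pairwise distinct identifiers in $\{0,\dots,n^{a}\}$ for a constant $a$. Initially each node knows its identifier, its degree, the weights of its incident edges (listed along an arbitrary local port numbering), and a number $L$, the same for all nodes, with $\frac1\kappa\log_2\Delta\le L\le\kappa\log_2\Delta$ for a constant $\kappa\ge1$ (with $\log_2 0:=0$). In every synchronous round each node sends a message of unlimited size to each neighbor, receives its neighbors' messages and updates its state by unlimited local computation; at some point it irrevocably outputs either one of its incident edges or "unmatched". The number of rounds is the number after which all nodes have produced their output. **Lemma.** For all constants $a\in\mathbb N$ and $\kappa\ge 1$ there are a deterministic algorithm in this model and a constant $C$ such that, on every such network, within at most $C\,(\log_2^2\Delta+\log^* n)$ rounds the algorithm computes a $256$-approximate maximum weighted matching: the outputs are consistent and describe a matching $M\subseteq E$ with $$\sum_{e\in M^*}w_e\;\le\;256\sum_{e\in M}w_e$$ for a maximum weighted matching $M^*$ of $G$. Here $\log^* n$ is the least number of times $\log_2$ has to be applied to $n$ to reach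 a value at most $1$. -/

import Mathlib

namespace DistMatching

/-- The iterated logarithm `log* x`: the least number of applications of `log₂` after which
the value is at most `1`. -/
noncomputable def logStar (x : ℝ) : ℕ :=
  sInf {k : ℕ | (Real.logb 2)^[k] x ≤ 1}

/-! ### The LOCAL model -/

/-- A network on the graph `G`: pairwise distinct identifiers, nonnegative edge weights, and an
arbitrary numbering, local to each node, of the links (ports) to its neighbors. -/
structure Network {V : Type} [Fintype V] (G : SimpleGraph V) [DecidableRel G.Adj] where
  id : V → ℕ
  id_injective : Function.Injective id
  weight : Sym2 V → ℝ
  weight_nonneg : ∀ e ∈ G.edgeSet, 0 ≤ weight e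
  port : ∀ v : V, G.neighborSet v ≃ Fin (G.degree v)

/-- A deterministic algorithm in the LOCAL model, run by every node of the network. Messages and
local computation are not limited. -/
structure LocalAlgorithm where
  /-- local states -/
  State : Type
  /-- messages -/
  Msg : Type
  /-- The initial state of a node is a function of its identifier, of the common estimate of
  `log Δ`, of its degree `d`, and of the weights of its incident edges, listed by port. -/
  init : (ident : ℕ) → (L : ℝ) → (d : ℕ) → (Fin d → ℝ) → State
  /-- the message sent through a given port -/
  send : State → ℕ → Msg
  /-- The new state, as a function of the old one and of the messages received, listed by port. -/
  receive : State → (ℕ → Option Msg) → State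
  /-- `none` : no output yet; `some none` : the output "unmatched"; `some (some p)` : the output
  "matched along the edge at port `p`". -/
  output : State → Option (Option ℕ)

section

variable {V : Type} [Fintype V] {G : SimpleGraph V} [DecidableRel G.Adj]

/-- The state of each node after `t` synchronous rounds. In each round every node sends one message
to each neighbor, receives those of its neighbors, and updates its state. -/
def LocalAlgorithm.run (A : LocalAlgorithm) (N : Network G) (L : ℝ) : ℕ → V → A.State
  | 0, v => A.init (N.id v) L (G.degree v) fun p => N.weight s(v, ((N.port v).symm p : V))
  | t + 1, v => A.receive (A.run N L t v) fun p =>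
      if h : p < G.degree v then
        let u : G.neighborSet v := (N.port v).symm ⟨p, h⟩
        some (A.send (A.run N L t u) (N.port u ⟨v, G.adj_symm u.2⟩))
      else none

/-- Within `T` rounds every node `v` has produced its output `y v`. Outputs are irrevocable: no
node ever announces anything but `y v`. -/
def LocalAlgorithm.OutputsWithin (A : LocalAlgorithm) (N : Network G) (L : ℝ) (T : ℕ)
    (y : V → Option ℕ) : Prop :=
  ∀ v, (∀ t, T ≤ t → A.output (A.run N L t v) = some (y v)) ∧
    ∀ t o, A.output (A.run N L t v) = some o → o = y v

/-- The outputs `y` describe the matching `M`: each node outputs the port that leads to its partner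
in `M` if there is one, and `none` otherwise. In particular both endpoints of an edge agree. -/
def Network.Describes (N : Network G) (y : V → Option ℕ) (M : G.Subgraph) : Prop :=
  ∀ v p, y v = some p ↔ ∃ u : G.neighborSet v, M.Adj v u ∧ (N.port v u : ℕ) = p

/-- The total weight of the edges of `M`. -/
noncomputable def matchingWeight (w : Sym2 V → ℝ) (M : G.Subgraph) : ℝ :=
  ∑ᶠ e ∈ M.edgeSet, w e

/-- `M` is a matching of maximum total weight. -/
def IsMaxWeightMatching (w : Sym2 V → ℝ) (M : G.Subgraph) : Prop :=
  M.IsMatching ∧ ∀ M' : G.Subgraph, M'.IsMatching → matchingWeight w M' ≤ matchingWeight w M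

/-- `M` is a `c`-approximate maximum weighted matching. -/
def IsApproxMaxWeightMatching (c : ℝ) (w : Sym2 V → ℝ) (M : G.Subgraph) : Prop :=
  M.IsMatching ∧ ∃ Mstar : G.Subgraph, IsMaxWeightMatching w Mstar ∧
    matchingWeight w Mstar ≤ c * matchingWeight w M

end

end DistMatching

namespace DistMatching

open Finset

/-! A matching is an independent set of the line graph, in which the neighbors of an edge are
covered by two cliques. Weights are first rounded down to powers of two, at the cost of a factor 2.
A fractional solution `x` is then found and rounded to 0/1 values. Its price is `conflict`, the sum
of `min (w e) (w f) * (x e * x f)` over ordered adjacent pairs.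

Starting from tiny values and doubling while the load within the own weight class is small gives a
solution whose conflict is at most half its weight (`conflict_doubling_le`) and whose weight is at
least 1/64 of that of any matching (`sum_le_doubling`). At the other end, the local maxima of a 0/1
solution weigh at least its weight minus half its conflict (`le_sum_chosen`). In between,
`roundStep_spec` removes the smallest positive value by doubling or deleting. The decisions are made
color by color, each following the sign of its marginal gain, so the objective restricted to
bichromatic pairs never drops. Monochromatic pairs are paid for by lowering the coefficient of the
conflict slightly in each step. The losses multiply to `2 * 2 * 64 = 256`.

Rounding needs `O(k)` colors, with `k = O(log Δ + 1)`, such that monochromatic pairs carry at most a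
`1 / (8 * k)` fraction of the current conflict (`defectiveColor_spec`). This coloring is recomputed
in each of the `O(k)` steps, in `O(k)` rounds. Its input is one proper coloring with `2 ^ (4 * k)`
colors, found in `log* n + O(1)` rounds by iterated polynomial hashing (`baseColor_spec`).

No node knows `n`, so nodes exchange everything they know and answer once their view forces the
answer. The time bound is then a statement about which views determine which labels: `LocalAt` is
propagated through every stage, and `provenOutput_of_localAt` turns it into termination. -/

/-! ### Polynomials over prime fields as hash functions -/

/-- The value at `x`, modulo `p`, of the polynomial whose coefficients are the `d` lowest digits
of `c` in base `p`. -/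
def digitEval (p d c x : ℕ) : ℕ := (∑ i ∈ range d, c / p ^ i % p * x ^ i) % p

/-- The least prime above `n`. -/
noncomputable def primeAbove (n : ℕ) : ℕ := sInf {p | p.Prime ∧ n < p}

theorem primeAbove_spec {n : ℕ} : (primeAbove n).Prime ∧ n < primeAbove n := by
  obtain ⟨p, h, hp⟩ := Nat.exists_infinite_primes (n + 1)
  exact Nat.sInf_mem (s := {p | p.Prime ∧ n < p}) ⟨p, hp, h⟩

theorem primeAbove_le {n : ℕ} (hn : n ≠ 0) : primeAbove n ≤ 2 * n := by
  obtain ⟨p, hp, h, h'⟩ := Nat.exists_prime_lt_and_le_two_mul n hn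
  exact (Nat.sInf_le (s := {p | p.Prime ∧ n < p}) ⟨hp, h⟩).trans h'

theorem digitEval_lt {p : ℕ} (hp : p.Prime) (d c x : ℕ) : digitEval p d c x < p :=
  Nat.mod_lt _ hp.pos

theorem eq_of_digits_eq {p : ℕ} (d : ℕ) : ∀ {c c' : ℕ}, c < p ^ d → c' < p ^ d →
    (∀ i < d, c / p ^ i % p = c' / p ^ i % p) → c = c' := by
  induction d with
  | zero => intro c c' h h' _; simp at h h'; omega
  | succ d ih =>
    intro c c' h h' hd
    have h0 := hd 0 (by omega)
    simp only [pow_zero, Nat.div_one] at h0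
    have h1 : c / p = c' / p := by
      refine ih (Nat.div_lt_of_lt_mul (by rwa [pow_succ'] at h))
        (Nat.div_lt_of_lt_mul (by rwa [pow_succ'] at h')) fun i hi => ?_
      rw [Nat.div_div_eq_div_mul, Nat.div_div_eq_div_mul, ← pow_succ']
      exact hd (i + 1) (by omega)
    rw [← Nat.div_add_mod c p, ← Nat.div_add_mod c' p, h0, h1]

open Polynomial in
/-- A nonzero polynomial of degree at most `d` has at most `d` roots among `0, …, p - 1`. -/
theorem card_range_roots_le {p d : ℕ} [Fact p.Prime] {f : (ZMod p)[X]} (hf : f ≠ 0)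
    (hd : f.natDegree ≤ d) {s : Finset ℕ} (hs : ∀ x ∈ s, x < p ∧ f.eval (x : ZMod p) = 0) :
    s.card ≤ d := by
  classical
  refine le_trans ?_ ((Multiset.toFinset_card_le f.roots).trans ((card_roots' f).trans hd))
  refine card_le_card_of_injOn (fun x : ℕ => (x : ZMod p)) (fun x hx => ?_) fun x hx y hy h => ?_
  · simpa [hf] using (hs x hx).2
  · have := (ZMod.natCast_eq_natCast_iff' _ _ _).1 h
    rwa [Nat.mod_eq_of_lt (hs x hx).1, Nat.mod_eq_of_lt (hs y hy).1] at this

section poly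

open Polynomial

/-- The polynomial whose coefficients are the `d` lowest digits of `c` in base `p`. -/
noncomputable def digitPoly (p d c : ℕ) : (ZMod p)[X] :=
  ∑ i ∈ range d, Polynomial.C ((c / p ^ i % p : ℕ) : ZMod p) * X ^ i

theorem natCast_digitEval (p d c x : ℕ) :
    (digitEval p d c x : ZMod p) = (digitPoly p d c).eval (x : ZMod p) := by
  simp [digitEval, digitPoly, eval_finsetSum]

theorem digitPoly_coeff {p d c i : ℕ} (hi : i < d) :
    (digitPoly p d c).coeff i = ((c / p ^ i % p : ℕ) : ZMod p) := by
  simp [digitPoly, coeff_X_pow, hi]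

theorem digitPoly_degree_lt (p d c : ℕ) : (digitPoly p d c).degree < d := by
  refine (degree_lt_iff_coeff_zero _ _).2 fun m hm => ?_
  simp [digitPoly, coeff_X_pow, hm.not_gt]

theorem digitPoly_injOn {p d c c' : ℕ} [Fact p.Prime] (hc : c < p ^ d) (hc' : c' < p ^ d)
    (h : digitPoly p d c = digitPoly p d c') : c = c' := by
  refine eq_of_digits_eq d hc hc' fun i hi => ?_
  have := congrArg (fun f => coeff f i) h
  simp only [digitPoly_coeff hi] at this
  rw [ZMod.natCast_eq_natCast_iff'] at this
  simpa using this

/-- Distinct numbers below `p ^ d` have distinct digit polynomials, and an agreement of the two is a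
root of their nonzero difference. This is the source of all collision bounds below. -/
theorem card_digitEval_eq_le {p d c c' : ℕ} (hp : p.Prime) (hc : c < p ^ d)
    (hc' : c' < p ^ d) (h : c ≠ c') :
    ((range p).filter fun x => digitEval p d c x = digitEval p d c' x).card ≤ d := by
  have := Fact.mk hp
  refine card_range_roots_le (f := digitPoly p d c - digitPoly p d c')
    (sub_ne_zero.2 fun h' => h (digitPoly_injOn hc hc' h')) ?_ fun x hx => ?_
  · refine natDegree_le_of_degree_le ((degree_sub_le _ _).trans ?_)
    exact max_le (digitPoly_degree_lt p d c).le (digitPoly_degree_lt p d c').le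
  · rw [Finset.mem_filter, mem_range] at hx
    refine ⟨hx.1, ?_⟩
    rw [eval_sub, ← natCast_digitEval, ← natCast_digitEval, hx.2, sub_self]

/-- `digitEval`, with an additional leading term `x ^ d`. -/
def monicEval (p d c x : ℕ) : ℕ := (digitEval p d c x + x ^ d) % p

theorem monicEval_lt {p : ℕ} (hp : p.Prime) (d c x : ℕ) : monicEval p d c x < p :=
  Nat.mod_lt _ hp.pos

theorem card_monicEval_eq_le {p d c c' : ℕ} (hp : p.Prime) (hc : c < p ^ d)
    (hc' : c' < p ^ d) (h : c ≠ c') :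
    ((range p).filter fun x => monicEval p d c x = monicEval p d c' x).card ≤ d := by
  refine le_trans (card_le_card fun x hx => ?_) (card_digitEval_eq_le hp hc hc' h)
  rw [Finset.mem_filter] at hx ⊢
  refine ⟨hx.1, ?_⟩
  have h1 : digitEval p d c x ≡ digitEval p d c' x [MOD p] := Nat.ModEq.add_right_cancel' _ hx.2
  have h2 : ∀ c, digitEval p d c x < p := fun c => Nat.mod_lt _ hp.pos
  rwa [Nat.ModEq, Nat.mod_eq_of_lt (h2 _), Nat.mod_eq_of_lt (h2 _)] at h1

/-- This is why a leading term is added: a monic polynomial of positive degree is never constant, so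
a moving element meets a stationary one only rarely. -/
theorem card_monicEval_const_le {p d c : ℕ} (hp : p.Prime) (y : ℕ) (hd : d ≠ 0) :
    ((range p).filter fun x => monicEval p d c x = y).card ≤ d := by
  have := Fact.mk hp
  have hdeg : (digitPoly p d c - Polynomial.C (y : ZMod p)).degree < d := by
    refine (degree_sub_le _ _).trans_lt (max_lt (digitPoly_degree_lt p d c) ?_)
    exact degree_C_le.trans_lt (by exact_mod_cast Nat.pos_of_ne_zero hd)
  have hm : (X ^ d + (digitPoly p d c - Polynomial.C (y : ZMod p))).Monic :=
    monic_X_pow_add hdeg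
  refine card_range_roots_le hm.ne_zero ?_ fun x hx => ?_
  · refine natDegree_le_of_degree_le ((degree_add_le _ _).trans (max_le ?_ hdeg.le))
    simp
  · rw [Finset.mem_filter, mem_range] at hx
    refine ⟨hx.1, ?_⟩
    have : ((monicEval p d c x : ℕ) : ZMod p) = y := by rw [hx.2]
    rw [monicEval, ZMod.natCast_mod] at this
    push_cast at this
    rw [natCast_digitEval] at this
    simp [← this]

end poly

/-- Pigeonhole: if each `f` hits at most `b` of the points `0, …, p - 1`, some point is hit by at
most the average weight. -/
theorem exists_point_of_card_le {E : Type*} (s : Finset E) (A : E → ℝ)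
    (hA : ∀ f ∈ s, 0 ≤ A f) {p b : ℕ} (hp : 0 < p) (P : E → ℕ → Prop) [∀ f x, Decidable (P f x)]
    (hP : ∀ f ∈ s, ((range p).filter (P f)).card ≤ b) :
    ∃ x < p, (∑ f ∈ s, if P f x then A f else 0) * p ≤ b * ∑ f ∈ s, A f := by
  by_contra! hcon
  -- If every point were worse than average, summing over all points and counting by `f` instead
  -- would contradict `hP`.
  have h1 : ∑ x ∈ range p, (b * ∑ f ∈ s, A f) <
      ∑ x ∈ range p, (∑ f ∈ s, if P f x then A f else 0) * p :=
    sum_lt_sum_of_nonempty (by simpa using hp.ne') fun x hx => hcon x (mem_range.1 hx)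
  rw [sum_const, card_range, nsmul_eq_mul, ← sum_mul, sum_comm, mul_comm] at h1
  have h2 := lt_of_mul_lt_mul_right h1 (Nat.cast_nonneg p)
  refine h2.not_ge ?_
  rw [mul_sum]
  refine sum_le_sum fun f hf => ?_
  rw [← sum_filter, sum_const, nsmul_eq_mul]
  exact mul_le_mul_of_nonneg_right (by exact_mod_cast hP f hf) (hA f hf)

theorem pair_eq_of_mul_add_eq {p x y x' y' : ℕ} (hy : y < p) (hy' : y' < p)
    (h : x * p + y = x' * p + y') : x = x' ∧ y = y' := by
  have hp : 0 < p := by omega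
  have h1 : (x * p + y) / p = x := by
    rw [mul_comm, Nat.mul_add_div hp, Nat.div_eq_of_lt hy, add_zero]
  have h2 : (x' * p + y') / p = x' := by
    rw [mul_comm, Nat.mul_add_div hp, Nat.div_eq_of_lt hy', add_zero]
  have h3 : x = x' := by rw [← h1, ← h2, h]
  subst h3
  exact ⟨rfl, by omega⟩

theorem mul_add_lt_sq {p x y : ℕ} (hx : x < p) (hy : y < p) : x * p + y < p ^ 2 := by
  nlinarith

section

variable {E : Type} (nb : E → Finset E)

/-! ### Proper colorings with a palette independent of the number of nodes -/

/-- `levelBits k` is a tower of twos that starts with `k`. -/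
def levelBits (k : ℕ) : ℕ → ℕ
  | 0 => k
  | j + 1 => 2 ^ levelBits k j

/-- The colors of level `j` are the numbers below `palette k j`. -/
def palette (k j : ℕ) : ℕ := 2 ^ (4 * levelBits k j)

theorem le_levelBits (k j : ℕ) : j ≤ levelBits k j := by
  induction j with
  | zero => simp
  | succ j ih => exact (Nat.succ_le_of_lt (ih.trans_lt Nat.lt_two_pow_self))

theorem start_le_levelBits (k j : ℕ) : k ≤ levelBits k j := by
  induction j with
  | zero => exact le_rfl
  | succ j ih => exact ih.trans Nat.lt_two_pow_self.le

theorem lt_palette_self (k i : ℕ) : i < palette k i :=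
  Nat.lt_two_pow_self.trans_le
    (Nat.pow_le_pow_right two_pos (by have := le_levelBits k i; omega))

/-- The level at which the color `i` starts. -/
noncomputable def startLevel (k i : ℕ) : ℕ := sInf {j | i < palette k j}

theorem lt_palette_startLevel (k i : ℕ) : i < palette k (startLevel k i) :=
  Nat.sInf_mem (s := {j | i < palette k j}) ⟨i, lt_palette_self k i⟩

theorem startLevel_le {k i j : ℕ} (h : i < palette k j) : startLevel k i ≤ j :=
  Nat.sInf_le (s := {j | i < palette k j}) h

/-- The field size used to move from level `j + 1` to level `j`. -/
noncomputable def levelPrime (k j : ℕ) : ℕ := primeAbove (2 ^ (2 * levelBits k j - 1))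

/-- The number of coefficients used to move from level `j + 1` to level `j`. -/
def levelDim (k j : ℕ) : ℕ := 4 * levelBits k (j + 1)

theorem levelPrime_prime (k j : ℕ) : (levelPrime k j).Prime := primeAbove_spec.1

/-- With `b = levelBits k j`, the exponent `2 * b - 1` leaves room for the factor 2 in Bertrand's
postulate. The prime is thus at most `2 ^ (2 * b)`, and a (point, value) pair fits into the lower
palette. -/
theorem sq_levelPrime_le {k j : ℕ} (hk : 4 ≤ k) : levelPrime k j ^ 2 ≤ palette k j := by
  have hb := start_le_levelBits k j
  have h : levelPrime k j ≤ 2 ^ (2 * levelBits k j) := by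
    refine (primeAbove_le (by positivity)).trans (le_of_eq ?_)
    rw [← pow_succ']
    congr 1
    omega
  calc levelPrime k j ^ 2 ≤ (2 ^ (2 * levelBits k j)) ^ 2 := Nat.pow_le_pow_left h 2
    _ = palette k j := by rw [palette, ← pow_mul]; congr 1; ring

theorem palette_succ_le (k j : ℕ) : palette k (j + 1) ≤ levelPrime k j ^ levelDim k j :=
  Nat.pow_le_pow_left (levelPrime_prime k j).two_le _

/-- The field is large enough that `2 ^ K` neighbors, each excluding at most `levelDim k j` points,
cannot exclude all of it. -/
theorem levelDim_mul_lt {k K j : ℕ} (hk : K + 4 ≤ k) :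
    levelDim k j * 2 ^ K < levelPrime k j := by
  have hb := start_le_levelBits k j
  refine lt_of_le_of_lt ?_ (primeAbove_spec (n := 2 ^ (2 * levelBits k j - 1))).2
  rw [levelDim, levelBits, show (4 : ℕ) = 2 ^ 2 by rfl, ← pow_add, ← pow_add]
  exact Nat.pow_le_pow_right two_pos (by omega)

/-- The color, at the level below, that evaluation at the point `x` produces. -/
noncomputable def loweredColor (k : ℕ) (a : ℕ × ℕ) (x : ℕ) : ℕ :=
  x * levelPrime k (a.1 - 1) +
    digitEval (levelPrime k (a.1 - 1)) (levelDim k (a.1 - 1)) a.2 x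

/-- Evaluation at `x` might give an element with label `a` the color of a neighbor with
label `b`. -/
def LoweringClash (k : ℕ) (a b : ℕ × ℕ) (x : ℕ) : Prop :=
  (b.1 = a.1 ∧ digitEval (levelPrime k (a.1 - 1)) (levelDim k (a.1 - 1)) b.2 x =
    digitEval (levelPrime k (a.1 - 1)) (levelDim k (a.1 - 1)) a.2 x) ∨
  (b.1 = 0 ∧ b.2 = loweredColor k a x)

/-- The point at which an element evaluates its polynomial to move down by one level. -/
noncomputable def loweringPoint (k : ℕ) (s : E → ℕ × ℕ) (e : E) : ℕ :=
  sInf {x | x < levelPrime k ((s e).1 - 1) ∧ ∀ f ∈ nb e, ¬ LoweringClash k (s e) (s f) x}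

/-- All elements above level `0` move down by one level. -/
noncomputable def lowerStep (k : ℕ) (s : E → ℕ × ℕ) (e : E) : ℕ × ℕ :=
  if (s e).1 = 0 then s e
  else ((s e).1 - 1, loweredColor k (s e) (loweringPoint nb k s e))

/-- Levels and colors after `n` steps. -/
noncomputable def lowered (k : ℕ) (ident : E → ℕ) (n : ℕ) : E → ℕ × ℕ :=
  (lowerStep nb k)^[n] fun e => (startLevel k (ident e), ident e)

/-- The color with which an element arrives at level `0`. -/
noncomputable def baseColor (k : ℕ) (ident : E → ℕ) (e : E) : ℕ :=
  (lowered nb k ident (startLevel k (ident e)) e).2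

/-- Colors lie in the palettes of their levels, and neighbors on the same level have different
colors. -/
def ProperlyLeveled (k : ℕ) (s : E → ℕ × ℕ) : Prop :=
  (∀ e, (s e).2 < palette k (s e).1) ∧ ∀ e, ∀ f ∈ nb e, s f ≠ s e

variable {nb}

theorem loweringPoint_spec {k K : ℕ} (hk : K + 4 ≤ k) {s : E → ℕ × ℕ}
    (hs : ProperlyLeveled nb k s) {e : E} (hdeg : (nb e).card ≤ 2 ^ K) (he : (s e).1 ≠ 0) :
    loweringPoint nb k s e < levelPrime k ((s e).1 - 1) ∧
      ∀ f ∈ nb e, ¬ LoweringClash k (s e) (s f) (loweringPoint nb k s e) := by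
  classical
  obtain ⟨j, hj⟩ := Nat.exists_eq_succ_of_ne_zero he
  have hp := levelPrime_prime k j
  refine Nat.sInf_mem (s := {x | x < levelPrime k ((s e).1 - 1) ∧
    ∀ f ∈ nb e, ¬ LoweringClash k (s e) (s f) x}) ?_
  have hlt : ∀ g, (s g).1 = j + 1 → (s g).2 < levelPrime k j ^ levelDim k j := fun g hg =>
    ((hs.1 g).trans_le (by rw [hg])).trans_le (palette_succ_le k j)
  obtain ⟨x, hx, hsum⟩ := exists_point_of_card_le (nb e) (fun _ => (1 : ℝ))
    (fun _ _ => zero_le_one) hp.pos (b := levelDim k j)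
    (fun f x => LoweringClash k (s e) (s f) x) fun f hf => by
      -- A neighbor on the same level clashes where two distinct polynomials agree. Any other
      -- neighbor clashes at one point at most, because the new color encodes the evaluation point.
      by_cases hfe : (s f).1 = (s e).1
      · refine (card_le_card fun x hx => ?_).trans
          (card_digitEval_eq_le hp (hlt f (hfe.trans hj)) (hlt e hj) ?_)
        · rw [mem_filter] at hx ⊢
          refine ⟨hx.1, ?_⟩
          rcases hx.2 with h | h
          · simpa [hj] using h.2
          · omega
        · exact fun h => hs.2 e f hf (Prod.ext hfe h)
      · refine le_trans (card_le_one.2 fun x hx y hy => ?_) (b := 1) ?_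
        · rw [mem_filter] at hx hy
          have hx' := (hx.2.resolve_left fun h => hfe h.1).2
          have hy' := (hy.2.resolve_left fun h => hfe h.1).2
          rw [hx', loweredColor, loweredColor, hj] at hy'
          exact (pair_eq_of_mul_add_eq (digitEval_lt hp _ _ _) (digitEval_lt hp _ _ _) hy').1
        · have : 0 < levelBits k (j + 1) := by simp [levelBits]
          rw [levelDim]
          omega
  refine ⟨x, by simpa [hj] using hx, fun f hf hclash => ?_⟩
  -- With unit weights, a single clash already contributes 1, while the average number of clashes is
  -- below 1.
  have h1 : (1 : ℝ) ≤ ∑ f ∈ nb e, if LoweringClash k (s e) (s f) x then (1 : ℝ) else 0 := by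
    refine le_trans (by simp [hclash]) (single_le_sum (f := fun f =>
      if LoweringClash k (s e) (s f) x then (1 : ℝ) else 0) (fun i _ => ?_) hf)
    split_ifs <;> norm_num
  have h2 : (levelDim k j : ℝ) * ∑ f ∈ nb e, (1 : ℝ) < levelPrime k j := by
    have := (Nat.mul_le_mul_left (levelDim k j) hdeg).trans_lt (levelDim_mul_lt (j := j) hk)
    simpa using (by exact_mod_cast this : ((levelDim k j * (nb e).card : ℕ) : ℝ) < levelPrime k j)
  have h3 : (0 : ℝ) < levelPrime k j := by exact_mod_cast hp.pos
  nlinarith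

theorem loweredColor_lt {k K : ℕ} (hk : K + 4 ≤ k) {s : E → ℕ × ℕ}
    (hs : ProperlyLeveled nb k s) {e : E} (hdeg : (nb e).card ≤ 2 ^ K) (he : (s e).1 ≠ 0) :
    loweredColor k (s e) (loweringPoint nb k s e) < palette k ((s e).1 - 1) :=
  (mul_add_lt_sq (loweringPoint_spec hk hs hdeg he).1
    (digitEval_lt (levelPrime_prime k _) _ _ _)).trans_le (sq_levelPrime_le (by omega))

/-- New coincidences need an element that moves. It avoids neighbors moving alongside it whatever
point they choose, since equal new colors would mean equal points and values. It also avoids those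
already waiting on level 0. -/
theorem ProperlyLeveled.lowerStep {k K : ℕ} (hk : K + 4 ≤ k) {s : E → ℕ × ℕ}
    (hsymm : ∀ e f, f ∈ nb e → e ∈ nb f)
    (hs : ProperlyLeveled nb k s) (hdeg : ∀ e, (nb e).card ≤ 2 ^ K) :
    ProperlyLeveled nb k (lowerStep nb k s) := by
  refine ⟨fun e => ?_, fun e f hf => ?_⟩
  · rw [DistMatching.lowerStep]
    split_ifs with he
    · exact hs.1 e
    · exact loweredColor_lt hk hs (hdeg e) he
  · have key : ∀ e f, f ∈ nb e → (s e).1 ≠ 0 → DistMatching.lowerStep nb k s f ≠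
        DistMatching.lowerStep nb k s e := by
      intro e f hf he h
      have hclash := (loweringPoint_spec hk hs (hdeg e) he).2 f hf
      rw [DistMatching.lowerStep, DistMatching.lowerStep, if_neg he] at h
      split_ifs at h with hf0
      · exact hclash (Or.inr ⟨hf0, congrArg Prod.snd h⟩)
      · have h1 : (s f).1 = (s e).1 := by
          have : (s f).1 - 1 = (s e).1 - 1 := congrArg Prod.fst h
          omega
        have h2 := congrArg Prod.snd h
        simp only [loweredColor, h1] at h2
        have h3 := pair_eq_of_mul_add_eq (digitEval_lt (levelPrime_prime k _) _ _ _)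
          (digitEval_lt (levelPrime_prime k _) _ _ _) h2
        exact hclash (Or.inl ⟨h1, by rw [← h3.2, h3.1]⟩)
    by_cases he : (s e).1 = 0
    · by_cases hf0 : (s f).1 = 0
      · simpa [DistMatching.lowerStep, he, hf0] using hs.2 e f hf
      · exact (key f e (hsymm e f hf) hf0).symm
    · exact key e f hf he

theorem properlyLeveled_lowered {k K : ℕ} (hk : K + 4 ≤ k) {ident : E → ℕ}
    (hsymm : ∀ e f, f ∈ nb e → e ∈ nb f) (hirr : ∀ e, e ∉ nb e)
    (hid : Function.Injective ident) (hdeg : ∀ e, (nb e).card ≤ 2 ^ K) (n : ℕ) :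
    ProperlyLeveled nb k (lowered nb k ident n) := by
  induction n with
  | zero =>
    refine ⟨fun e => lt_palette_startLevel k (ident e), fun e f hf h => hirr e ?_⟩
    rwa [hid (congrArg Prod.snd h)] at hf
  | succ n ih =>
    rw [lowered, Function.iterate_succ_apply']
    exact ih.lowerStep hk hsymm hdeg

theorem lowered_fst (k : ℕ) (ident : E → ℕ) (n : ℕ) (e : E) :
    (lowered nb k ident n e).1 = startLevel k (ident e) - n := by
  induction n with
  | zero => rfl
  | succ n ih =>
    rw [lowered, Function.iterate_succ_apply', ← lowered, lowerStep]
    split_ifs with h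
    · omega
    · omega

/-- Elements freeze on level 0, so the final color does not depend on when it is read. In particular
no common stopping time has to be known. -/
theorem lowered_eq {k : ℕ} {ident : E → ℕ} {n : ℕ} {e : E} (hn : startLevel k (ident e) ≤ n) :
    lowered nb k ident n e = (0, baseColor nb k ident e) := by
  induction n, hn using Nat.le_induction with
  | base => exact Prod.ext (by simp [lowered_fst]) rfl
  | succ n hn ih =>
    rw [lowered, Function.iterate_succ_apply', ← lowered, lowerStep, ih, if_pos rfl]

theorem baseColor_spec [Finite E] {k K : ℕ} (hk : K + 4 ≤ k) {ident : E → ℕ}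
    (hsymm : ∀ e f, f ∈ nb e → e ∈ nb f) (hirr : ∀ e, e ∉ nb e)
    (hid : Function.Injective ident) (hdeg : ∀ e, (nb e).card ≤ 2 ^ K) :
    (∀ e, baseColor nb k ident e < 2 ^ (4 * k)) ∧
      ∀ e, ∀ f ∈ nb e, baseColor nb k ident f ≠ baseColor nb k ident e := by
  have := Fintype.ofFinite E
  -- The sum merely serves as a time by which everyone has arrived; it does not enter the round
  -- count.
  have hn : ∀ e, startLevel k (ident e) ≤ ∑ e, startLevel k (ident e) := fun e =>
    single_le_sum (f := fun e => startLevel k (ident e)) (fun _ _ => zero_le) (mem_univ e)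
  have hs := properlyLeveled_lowered hk hsymm hirr hid hdeg (∑ e, startLevel k (ident e))
  refine ⟨fun e => ?_, fun e f hf h => hs.2 e f hf ?_⟩
  · simpa [lowered_eq (hn e), palette, levelBits] using hs.1 e
  · rw [lowered_eq (hn e), lowered_eq (hn f), h]

/-! ### Colorings with few colors and small weighted defect -/

variable (nb)

/-- A point at which the polynomials of few neighbors, by weight, agree with that of `e`. -/
noncomputable def hashPoint (p d : ℕ) (A : E → E → ℝ) (c : E → ℕ) (e : E) : ℕ :=
  sInf {x | x < p ∧ (∑ f ∈ nb e, if digitEval p d (c f) x = digitEval p d (c e) x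
    then A e f else 0) * p ≤ d * ∑ f ∈ nb e, A e f}

/-- A color below `p ^ 2`. -/
noncomputable def hashColor (p d : ℕ) (A : E → E → ℝ) (c : E → ℕ) (e : E) : ℕ :=
  hashPoint nb p d A c e * p + digitEval p d (c e) (hashPoint nb p d A c e)

/-- At time `t` every element that has not stopped is at the position given by its polynomial.
It stops there if few neighbors, by weight, are at the same position. -/
noncomputable def slide (p d : ℕ) (A : E → E → ℝ) (c : E → ℕ) : ℕ → E → Option ℕ
  | 0 => fun _ => none
  | t + 1 => fun e =>
    (slide p d A c t e).orElse fun _ =>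
      if (∑ f ∈ nb e, if c f ≠ c e ∧
          (slide p d A c t f).getD (monicEval p d (c f) t) = monicEval p d (c e) t
          then A e f else 0) * p ≤ (2 * d : ℕ) * ∑ f ∈ nb e, A e f
      then some (monicEval p d (c e) t) else none

/-- The position at which an element has stopped after `p` steps. -/
noncomputable def slideColor (p d : ℕ) (A : E → E → ℝ) (c : E → ℕ) (e : E) : ℕ :=
  (slide nb p d A c p e).getD 0

variable {nb}

theorem sum_nb_comm [Fintype E] (hsymm : ∀ e f, f ∈ nb e → e ∈ nb f) (g : E → E → ℝ) :
    ∑ e, ∑ f ∈ nb e, g e f = ∑ e, ∑ f ∈ nb e, g f e :=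
  sum_comm' fun e f => by simpa using ⟨hsymm e f, hsymm f e⟩

/-- Equal new colors force equal evaluation points, hence a collision at the point chosen by `e`,
which was selected to have at most average collision weight. -/
theorem hashColor_spec [Fintype E] {p d : ℕ} (hp : p.Prime) {A : E → E → ℝ}
    (hA : ∀ e f, 0 ≤ A e f) {c : E → ℕ} (hc : ∀ e, c e < p ^ d)
    (hne : ∀ e, ∀ f ∈ nb e, c f ≠ c e) :
    (∀ e, hashColor nb p d A c e < p ^ 2) ∧
      (∑ e, ∑ f ∈ nb e, if hashColor nb p d A c f = hashColor nb p d A c e then A e f else 0) * p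
        ≤ d * ∑ e, ∑ f ∈ nb e, A e f := by
  classical
  have h : ∀ e, hashPoint nb p d A c e < p ∧ (∑ f ∈ nb e,
      if digitEval p d (c f) (hashPoint nb p d A c e) =
        digitEval p d (c e) (hashPoint nb p d A c e) then A e f else 0) * p
      ≤ d * ∑ f ∈ nb e, A e f := by
    intro e
    exact Nat.sInf_mem (s := {x | x < p ∧ (∑ f ∈ nb e, if digitEval p d (c f) x =
      digitEval p d (c e) x then A e f else 0) * p ≤ d * ∑ f ∈ nb e, A e f}) (exists_point_of_card_le (nb e) (A e) (fun f _ => hA e f) hp.pos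
      (fun f x => digitEval p d (c f) x = digitEval p d (c e) x)
      fun f hf => card_digitEval_eq_le hp (hc f) (hc e) (hne e f hf))
  refine ⟨fun e => mul_add_lt_sq (h e).1 (digitEval_lt hp _ _ _), ?_⟩
  rw [sum_mul, mul_sum]
  refine sum_le_sum fun e _ => le_trans ?_ (h e).2
  refine mul_le_mul_of_nonneg_right (sum_le_sum fun f _ => ?_) (Nat.cast_nonneg p)
  split_ifs with h1 h2 h2
  · exact le_rfl
  · have := pair_eq_of_mul_add_eq (digitEval_lt hp _ _ _) (digitEval_lt hp _ _ _) h1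
    rw [this.1] at this
    exact absurd this.2 h2
  · exact hA e f
  · exact le_rfl

theorem slide_succ (p d : ℕ) (A : E → E → ℝ) (c : E → ℕ) (t : ℕ) (e : E) :
    slide nb p d A c (t + 1) e = (slide nb p d A c t e).orElse fun _ =>
      if (∑ f ∈ nb e, if c f ≠ c e ∧
          (slide nb p d A c t f).getD (monicEval p d (c f) t) = monicEval p d (c e) t
          then A e f else 0) * p ≤ (2 * d : ℕ) * ∑ f ∈ nb e, A e f
      then some (monicEval p d (c e) t) else none :=
  rfl

theorem slide_mono {p d : ℕ} {A : E → E → ℝ} {c : E → ℕ} {t t' : ℕ} (h : t ≤ t') {e : E} {y : ℕ}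
    (hy : slide nb p d A c t e = some y) : slide nb p d A c t' e = some y := by
  induction t', h using Nat.le_induction with
  | base => exact hy
  | succ t' _ ih => simp [slide_succ, ih]

theorem slide_position {p d : ℕ} {A : E → E → ℝ} {c : E → ℕ} {t : ℕ} (ht : t ≤ p) (f : E) :
    (slide nb p d A c t f).getD (monicEval p d (c f) t) = monicEval p d (c f) t ∨
      (slide nb p d A c t f).getD (monicEval p d (c f) t) = slideColor nb p d A c f := by
  cases h : slide nb p d A c t f with
  | none => exact Or.inl rfl
  | some y => right; simp [slideColor, slide_mono ht h]

/-- A neighbor of another color obstructs at most `2 * d` times: `d` times while moving, and `d`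
times at its final position. By averaging, some time below `p` meets the stopping condition. -/
theorem exists_slide_stop {p d : ℕ} (hp : p.Prime) (hd : d ≠ 0) {A : E → E → ℝ}
    (hA : ∀ e f, 0 ≤ A e f) {c : E → ℕ} (hc : ∀ e, c e < p ^ d) (e : E) :
    ∃ t < p, slide nb p d A c t e = none ∧
      slide nb p d A c (t + 1) e = some (monicEval p d (c e) t) := by
  classical
  obtain ⟨t, ht, hsum⟩ := exists_point_of_card_le (nb e) (A e) (fun f _ => hA e f) hp.pos
    (b := 2 * d) (fun f t => c f ≠ c e ∧
      (slide nb p d A c t f).getD (monicEval p d (c f) t) = monicEval p d (c e) t) fun f _ => by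
      by_cases hfe : c f = c e
      · simp [hfe]
      · rw [two_mul]
        refine le_trans (card_le_card fun t ht => ?_) ((card_union_le _ _).trans (add_le_add
          (card_monicEval_eq_le hp (hc f) (hc e) hfe)
          (card_monicEval_const_le (c := c e) hp (slideColor nb p d A c f) hd)))
        rw [mem_filter] at ht
        rw [mem_union, mem_filter, mem_filter]
        rcases slide_position (A := A) (nb := nb) (d := d) (c := c)
          (mem_range.1 ht.1).le f with h | h
        · exact Or.inl ⟨ht.1, h.symm.trans ht.2.2⟩
        · exact Or.inr ⟨ht.1, (h.symm.trans ht.2.2).symm⟩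
  -- The element may have stopped before the time found by averaging, so the first stopping time is
  -- taken.
  have hsome : ∃ t, slide nb p d A c (t + 1) e ≠ none := by
    refine ⟨t, ?_⟩
    cases h : slide nb p d A c t e with
    | none =>
      rw [slide_succ, h, Option.orElse_none, if_pos hsum]
      exact Option.some_ne_none _
    | some y => simp [slide_succ, h]
  have hle : Nat.find hsome ≤ t := by
    refine Nat.find_min' hsome ?_
    cases h : slide nb p d A c t e with
    | none =>
      rw [slide_succ, h, Option.orElse_none, if_pos hsum]
      exact Option.some_ne_none _
    | some y => simp [slide_succ, h]
  have hnone : slide nb p d A c (Nat.find hsome) e = none := by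
    cases h : Nat.find hsome with
    | zero => rfl
    | succ n => exact not_not.1 (Nat.find_min hsome (m := n) (by omega))
  refine ⟨Nat.find hsome, hle.trans_lt ht, hnone, ?_⟩
  have := Nat.find_spec hsome
  rw [slide_succ, hnone, Option.orElse_none] at this ⊢
  split_ifs at this ⊢ with h
  · rfl
  · exact absurd rfl this

theorem slide_stop_weight {p d : ℕ} {A : E → E → ℝ} {c : E → ℕ} {t : ℕ} {e : E}
    (h0 : slide nb p d A c t e = none)
    (h1 : slide nb p d A c (t + 1) e = some (monicEval p d (c e) t)) :
    (∑ f ∈ nb e, if c f ≠ c e ∧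
      (slide nb p d A c t f).getD (monicEval p d (c f) t) = monicEval p d (c e) t
      then A e f else 0) * p ≤ (2 * d : ℕ) * ∑ f ∈ nb e, A e f := by
  by_contra hcon
  rw [slide_succ, h0, Option.orElse_none, if_neg hcon] at h1
  exact Option.some_ne_none _ h1.symm

theorem slideColor_spec [Fintype E] {p d : ℕ} (hp : p.Prime) (hd : d ≠ 0)
    (hsymm : ∀ e f, f ∈ nb e → e ∈ nb f) {A : E → E → ℝ} (hA : ∀ e f, 0 ≤ A e f)
    (hAsymm : ∀ e f, A e f = A f e) {c : E → ℕ} (hc : ∀ e, c e < p ^ d) :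
    (∀ e, slideColor nb p d A c e < p) ∧
      (∑ e, ∑ f ∈ nb e, if c f ≠ c e ∧ slideColor nb p d A c f = slideColor nb p d A c e
        then A e f else 0) * p ≤ (4 * d : ℕ) * ∑ e, ∑ f ∈ nb e, A e f := by
  classical
  choose τ hτp hτ0 hτ1 using exists_slide_stop (nb := nb) hp hd hA hc
  have hcol : ∀ e, slideColor nb p d A c e = monicEval p d (c e) (τ e) := fun e => by
    simp [slideColor, slide_mono (hτp e) (hτ1 e)]
  refine ⟨fun e => by rw [hcol]; exact monicEval_lt hp _ _ _, ?_⟩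
  set χ := slideColor nb p d A c with hχ
  have hhalf : (∑ e, ∑ f ∈ nb e, if (c f ≠ c e ∧ χ f = χ e) ∧ τ f ≤ τ e then A e f else 0) * p
      ≤ (2 * d : ℕ) * ∑ e, ∑ f ∈ nb e, A e f := by
    rw [sum_mul, mul_sum]
    refine sum_le_sum fun e _ => le_trans ?_ (slide_stop_weight (hτ0 e) (hτ1 e))
    refine mul_le_mul_of_nonneg_right (sum_le_sum fun f _ => ?_) (Nat.cast_nonneg p)
    split_ifs with h1 h2 h2
    · exact le_rfl
    · refine absurd ⟨h1.1.1, ?_⟩ h2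
      rw [← hcol, ← h1.1.2]
      -- An earlier stopper already stands at its final color; a simultaneous one is still moving
      -- but is at that position at this very time.
      rcases h1.2.lt_or_eq with h | h
      · rw [slide_mono h (hτ1 f), hcol]
        rfl
      · rw [← h, hτ0 f, hcol]
        rfl
    · exact hA e f
    · exact le_rfl
  -- Each pair is charged to an endpoint that stops last; by symmetry of `A` the two orders double
  -- `2 * d` to `4 * d`.
  have hle : (∑ e, ∑ f ∈ nb e, if c f ≠ c e ∧ χ f = χ e then A e f else 0) ≤
      (∑ e, ∑ f ∈ nb e, if (c f ≠ c e ∧ χ f = χ e) ∧ τ f ≤ τ e then A e f else 0) +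
      ∑ e, ∑ f ∈ nb e, if (c f ≠ c e ∧ χ f = χ e) ∧ τ f ≤ τ e then A e f else 0 := by
    refine le_trans ?_ (add_le_add le_rfl (sum_nb_comm hsymm fun e f =>
      if (c f ≠ c e ∧ χ f = χ e) ∧ τ f ≤ τ e then A e f else 0).ge)
    rw [← sum_add_distrib]
    refine sum_le_sum fun e _ => ?_
    rw [← sum_add_distrib]
    refine sum_le_sum fun f _ => ?_
    by_cases h : c f ≠ c e ∧ χ f = χ e
    · have h' : c e ≠ c f ∧ χ e = χ f := ⟨h.1.symm, h.2.symm⟩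
      have := hA e f
      rw [if_pos h, hAsymm f e]
      rcases le_total (τ e) (τ f) with ht | ht
      · rw [if_pos (⟨h', ht⟩ : (c e ≠ c f ∧ χ e = χ f) ∧ τ e ≤ τ f)]
        split_ifs <;> linarith
      · rw [if_pos (⟨h, ht⟩ : (c f ≠ c e ∧ χ f = χ e) ∧ τ f ≤ τ e)]
        split_ifs <;> linarith
    · rw [if_neg h]
      exact add_nonneg (by split_ifs <;> simp [hA]) (by split_ifs <;> simp [hA])
  have := mul_le_mul_of_nonneg_right hle (Nat.cast_nonneg p)
  push_cast at hhalf ⊢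
  linarith

variable (nb)

/-- The number of colors used by `defectiveColor`. -/
noncomputable def slidePrime (k : ℕ) : ℕ := primeAbove (256 * k)

/-- A coloring with few colors such that few pairs of neighbors, by weight, have the same color. -/
noncomputable def defectiveColor (k : ℕ) (A : E → E → ℝ) (c : E → ℕ) : E → ℕ :=
  slideColor nb (slidePrime k) 4 A (hashColor nb (primeAbove (64 * k ^ 2)) (4 * k) A c)

variable {nb}

/-- Hashing and sliding each lose at most a `1 / (16 * k)` fraction: `4 * k` over a prime above `64
* k ^ 2`, then `4 * 4` over a prime above `256 * k`. -/
theorem defectiveColor_spec [Fintype E] {k : ℕ} (hk : 0 < k)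
    (hsymm : ∀ e f, f ∈ nb e → e ∈ nb f) {A : E → E → ℝ} (hA : ∀ e f, 0 ≤ A e f)
    (hAsymm : ∀ e f, A e f = A f e) {c : E → ℕ} (hc : ∀ e, c e < 2 ^ (4 * k))
    (hne : ∀ e, ∀ f ∈ nb e, c f ≠ c e) :
    (∀ e, defectiveColor nb k A c e < slidePrime k) ∧
      (∑ e, ∑ f ∈ nb e,
        if defectiveColor nb k A c f = defectiveColor nb k A c e then A e f else 0) * (8 * k)
        ≤ ∑ e, ∑ f ∈ nb e, A e f := by
  obtain ⟨hp, hp1⟩ := primeAbove_spec (n := 64 * k ^ 2)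
  have hp2 := primeAbove_le (n := 64 * k ^ 2) (by positivity)
  obtain ⟨hq, hq1⟩ := primeAbove_spec (n := 256 * k)
  set p := primeAbove (64 * k ^ 2)
  have hh := hashColor_spec (nb := nb) hp hA
    (fun e => (hc e).trans_le (Nat.pow_le_pow_left hp.two_le _)) hne
  -- Since `p ≤ 128 * k ^ 2 ≤ (256 * k) ^ 2`, the hashed colors have at most four digits in base
  -- `slidePrime k`.
  have hlt : p ^ 2 ≤ slidePrime k ^ 4 := by
    rw [show slidePrime k ^ 4 = (slidePrime k ^ 2) ^ 2 by ring]
    refine Nat.pow_le_pow_left ?_ 2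
    have : 256 * k < slidePrime k := hq1
    nlinarith
  have hs := slideColor_spec (nb := nb) (p := slidePrime k) hq four_ne_zero hsymm hA hAsymm
    (c := hashColor nb p (4 * k) A c) fun e => (hh.1 e).trans_le hlt
  refine ⟨hs.1, ?_⟩
  have h1 := hh.2
  have h2 := hs.2
  have hle : (∑ e, ∑ f ∈ nb e,
      if defectiveColor nb k A c f = defectiveColor nb k A c e then A e f else 0) ≤
      (∑ e, ∑ f ∈ nb e, if hashColor nb p (4 * k) A c f = hashColor nb p (4 * k) A c e
        then A e f else 0) +
      ∑ e, ∑ f ∈ nb e, if hashColor nb p (4 * k) A c f ≠ hashColor nb p (4 * k) A c e ∧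
        slideColor nb (slidePrime k) 4 A (hashColor nb p (4 * k) A c) f =
        slideColor nb (slidePrime k) 4 A (hashColor nb p (4 * k) A c) e then A e f else 0 := by
    simp only [← sum_add_distrib]
    refine sum_le_sum fun e _ => sum_le_sum fun f _ => ?_
    have := hA e f
    rw [defectiveColor]
    split_ifs with a b b b b b <;> first | linarith | (exfalso; tauto)
  set X := ∑ e, ∑ f ∈ nb e, if hashColor nb p (4 * k) A c f = hashColor nb p (4 * k) A c e
        then A e f else 0
  set Y := ∑ e, ∑ f ∈ nb e, if hashColor nb p (4 * k) A c f ≠ hashColor nb p (4 * k) A c e ∧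
        slideColor nb (slidePrime k) 4 A (hashColor nb p (4 * k) A c) f =
        slideColor nb (slidePrime k) 4 A (hashColor nb p (4 * k) A c) e then A e f else 0
  set S := ∑ e, ∑ f ∈ nb e, A e f
  have hX : 0 ≤ X := sum_nonneg fun e _ => sum_nonneg fun f _ => by
    split_ifs <;> simp [hA]
  have hY : 0 ≤ Y := sum_nonneg fun e _ => sum_nonneg fun f _ => by
    split_ifs <;> simp [hA]
  have hk' : (0 : ℝ) < k := by exact_mod_cast hk
  have hX' : X * (16 * k) ≤ S := by
    have : (64 * k ^ 2 : ℝ) ≤ p := by exact_mod_cast hp1.le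
    have := mul_le_mul_of_nonneg_left this hX
    push_cast at h1
    have h3 : (4 * k : ℝ) * (X * (16 * k)) ≤ 4 * k * S := by nlinarith
    exact le_of_mul_le_mul_left h3 (by positivity)
  have hY' : Y * (16 * k) ≤ S := by
    have : (256 * k : ℝ) ≤ slidePrime k := by exact_mod_cast hq1.le
    have := mul_le_mul_of_nonneg_left this hY
    push_cast at h2
    linarith
  have := mul_le_mul_of_nonneg_right hle (by positivity : (0 : ℝ) ≤ 8 * k)
  linarith

end

section

variable {E : Type} (nb : E → Finset E)

/-! ### Rounding a fractional solution -/

/-- The price of choosing two neighbors: the weight of the lighter one is lost. -/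
def pairCost (w x : E → ℝ) (e f : E) : ℝ := min (w e) (w f) * (x e * x f)

/-- The price of a fractional solution, each pair being counted twice. -/
def conflict [Fintype E] (w x : E → ℝ) : ℝ := ∑ e, ∑ f ∈ nb e, pairCost w x e f

/-- The elements of value `r` decide, one color after the other, whether to move to `2 * r` or
to `0`. -/
noncomputable def sweep (w : E → ℝ) (χ : E → ℕ) (μ r : ℝ) (x : E → ℝ) : ℕ → E → ℝ
  | 0 => x
  | t + 1 => fun e =>
    if χ e = t ∧ x e = r then
      if 0 ≤ w e - μ * ∑ f ∈ nb e, (if χ f ≠ χ e then min (w e) (w f) * sweep w χ μ r x t f else 0)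
      then 2 * r else 0
    else sweep w χ μ r x t e

/-- All elements of value `2⁻¹ ^ (j + 1)` move to `2⁻¹ ^ j` or to `0`. -/
noncomputable def roundStep (k : ℕ) (c : E → ℕ) (w : E → ℝ) (j : ℕ) (x : E → ℝ) : E → ℝ :=
  sweep nb w (defectiveColor nb k (pairCost w x) c) (1 + j / k) (2⁻¹ ^ (j + 1)) x (slidePrime k)

/-- Rounding of a solution with values `0` and `2⁻¹ ^ i`, `i ≤ j`, to the values `0` and `1`. -/
noncomputable def roundAll (k : ℕ) (c : E → ℕ) (w : E → ℝ) : ℕ → (E → ℝ) → E → ℝ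
  | 0, x => x
  | j + 1, x => roundAll k c w j (roundStep nb k c w j x)

/-- The values of `x` are `0` and `2⁻¹ ^ i`, `i ≤ j`. -/
def IsDyadic (j : ℕ) (x : E → ℝ) : Prop := ∀ e, x e = 0 ∨ ∃ i ≤ j, x e = 2⁻¹ ^ i

theorem IsDyadic.nonneg {j : ℕ} {x : E → ℝ} (h : IsDyadic j x) (e : E) : 0 ≤ x e := by
  rcases h e with h | ⟨i, -, h⟩ <;> rw [h]
  positivity

variable {nb}

section sweep

variable {w : E → ℝ} {χ : E → ℕ} {μ r : ℝ} {x : E → ℝ}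

theorem sweep_succ (t : ℕ) (e : E) : sweep nb w χ μ r x (t + 1) e =
    if χ e = t ∧ x e = r then
      if 0 ≤ w e - μ * ∑ f ∈ nb e, (if χ f ≠ χ e then min (w e) (w f) * sweep nb w χ μ r x t f else 0)
      then 2 * r else 0
    else sweep nb w χ μ r x t e :=
  rfl

theorem sweep_of_ne {t : ℕ} {e : E} (h : x e ≠ r) : sweep nb w χ μ r x t e = x e := by
  induction t with
  | zero => rfl
  | succ t ih => rw [sweep_succ, if_neg fun h' => h h'.2, ih]

theorem sweep_of_le {t : ℕ} {e : E} (h : t ≤ χ e) : sweep nb w χ μ r x t e = x e := by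
  induction t with
  | zero => rfl
  | succ t ih => rw [sweep_succ, if_neg fun h' => by omega, ih (by omega)]

theorem sweep_of_lt {t : ℕ} {e : E} (h : χ e < t) (hr : x e = r) :
    sweep nb w χ μ r x t e = 2 * r ∨ sweep nb w χ μ r x t e = 0 := by
  induction t with
  | zero => omega
  | succ t ih =>
    rw [sweep_succ]
    split_ifs with h1 h2
    · exact Or.inl rfl
    · exact Or.inr rfl
    · exact ih (lt_of_le_of_ne (by omega) fun h' => h1 ⟨h', hr⟩)

variable [Fintype E]

/-- Since `hδ` kills the second-order term, the gain of a simultaneous change is the sum of the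
individual marginal gains. -/
theorem objective_add (hsymm : ∀ e f, f ∈ nb e → e ∈ nb f) {B : E → E → ℝ}
    (hB : ∀ e f, B e f = B f e) {z δ : E → ℝ} (hδ : ∀ e f, B e f * (δ e * δ f) = 0) :
    ∑ e, w e * (z e + δ e) - μ / 2 * ∑ e, ∑ f ∈ nb e, B e f * ((z e + δ e) * (z f + δ f)) =
      ∑ e, w e * z e - μ / 2 * ∑ e, ∑ f ∈ nb e, B e f * (z e * z f) +
        ∑ e, δ e * (w e - μ * ∑ f ∈ nb e, B e f * z f) := by
  have h1 : ∑ e, ∑ f ∈ nb e, B e f * ((z e + δ e) * (z f + δ f)) =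
      ∑ e, ∑ f ∈ nb e, B e f * (z e * z f) + ∑ e, ∑ f ∈ nb e, B e f * (δ e * z f) +
        ∑ e, ∑ f ∈ nb e, B e f * (z e * δ f) := by
    simp only [← sum_add_distrib]
    refine sum_congr rfl fun e _ => sum_congr rfl fun f _ => ?_
    linear_combination hδ e f
  have h2 : ∑ e, ∑ f ∈ nb e, B e f * (z e * δ f) = ∑ e, ∑ f ∈ nb e, B e f * (δ e * z f) := by
    rw [sum_nb_comm hsymm]
    refine sum_congr rfl fun e _ => sum_congr rfl fun f _ => ?_
    rw [hB f e]
    ring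
  have h3 : ∑ e, δ e * (w e - μ * ∑ f ∈ nb e, B e f * z f) =
      ∑ e, w e * δ e - μ * ∑ e, ∑ f ∈ nb e, B e f * (δ e * z f) := by
    rw [mul_sum, ← sum_sub_distrib]
    refine sum_congr rfl fun e _ => ?_
    rw [mul_sub, mul_left_comm, mul_sum]
    congr 1
    · ring
    · congr 1
      exact sum_congr rfl fun f _ => by ring
  rw [h1, h2, h3]
  simp only [mul_add, sum_add_distrib]
  ring

/-- Only one color class changes at a time, and pairs inside it are not counted. Each change is `r`
or `-r`, with the sign of its marginal gain, so every summand of the increment is nonnegative. -/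
theorem objective_sweep_le (hsymm : ∀ e f, f ∈ nb e → e ∈ nb f) (hr : 0 ≤ r) (t : ℕ) :
    ∑ e, w e * x e - μ / 2 * ∑ e, ∑ f ∈ nb e,
        (if χ f ≠ χ e then min (w e) (w f) else 0) * (x e * x f) ≤
      ∑ e, w e * sweep nb w χ μ r x t e - μ / 2 * ∑ e, ∑ f ∈ nb e,
        (if χ f ≠ χ e then min (w e) (w f) else 0) *
          (sweep nb w χ μ r x t e * sweep nb w χ μ r x t f) := by
  induction t with
  | zero => exact le_rfl
  | succ t ih =>
    refine ih.trans ?_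
    set z := sweep nb w χ μ r x t with hz
    set z' := sweep nb w χ μ r x (t + 1) with hz'
    have hne : ∀ e, χ e ≠ t → z' e - z e = 0 := fun e he => by
      rw [hz', sweep_succ, if_neg fun h => he h.1, sub_self]
    have h := objective_add (w := w) (μ := μ) hsymm
      (B := fun e f => if χ f ≠ χ e then min (w e) (w f) else 0) (z := z)
      (δ := fun e => z' e - z e) (fun e f => by simp only [ne_comm, min_comm]) fun e f => by
        by_cases he : χ e = t
        · by_cases hf : χ f = t
          · simp [he, hf]
          · simp [hne f hf]
        · simp [hne e he]
    simp only [add_sub_cancel] at h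
    rw [h]
    refine le_add_of_nonneg_right (sum_nonneg fun e _ => ?_)
    by_cases he : χ e = t ∧ x e = r
    · have hze : z e = r := by rw [hz, sweep_of_le he.1.ge, he.2]
      have hze' : z' e = if 0 ≤ w e - μ * ∑ f ∈ nb e,
          (if χ f ≠ χ e then min (w e) (w f) * z f else 0) then 2 * r else 0 := by
        rw [hz', sweep_succ, if_pos he]
      rw [hze, hze']
      simp only [ite_mul, zero_mul]
      split_ifs with hs
      · exact mul_nonneg (by linarith) hs
      · exact mul_nonneg_of_nonpos_of_nonpos (by linarith) (not_le.1 hs).le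
    · have : z' e = z e := by rw [hz', sweep_succ, if_neg he]
      rw [this, sub_self, zero_mul]

end sweep

variable {k : ℕ} {c : E → ℕ} {w : E → ℝ}

/-- The sweep ignores monochromatic pairs. Their price grows at most fourfold, to at most `conflict
/ (2 * k)`, which is exactly what the decrease of the coefficient by `1 / (2 * k)` releases. -/
theorem roundStep_spec [Fintype E] (hk : 0 < k) (hsymm : ∀ e f, f ∈ nb e → e ∈ nb f) (hw : ∀ e, 0 ≤ w e)
    (hc : ∀ e, c e < 2 ^ (4 * k)) (hne : ∀ e, ∀ f ∈ nb e, c f ≠ c e) {j : ℕ} (hj : j + 1 ≤ k)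
    {x : E → ℝ} (hx : IsDyadic (j + 1) x) :
    IsDyadic j (roundStep nb k c w j x) ∧
      ∑ e, w e * x e - (1 + (j + 1 : ℕ) / k) / 2 * conflict nb w x ≤
        ∑ e, w e * roundStep nb k c w j x e -
          (1 + j / k) / 2 * conflict nb w (roundStep nb k c w j x) := by
  have hx0 := hx.nonneg
  have hA : ∀ e f, 0 ≤ pairCost w x e f := fun e f =>
    mul_nonneg (le_min (hw e) (hw f)) (mul_nonneg (hx0 e) (hx0 f))
  obtain ⟨hlt, hmono⟩ := defectiveColor_spec (nb := nb) hk hsymm hA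
    (fun e f => by rw [pairCost, pairCost, min_comm, mul_comm (x e)]) hc hne
  have hobj := objective_sweep_le (w := w) (χ := defectiveColor nb k (pairCost w x) c)
    (μ := 1 + j / k) (r := 2⁻¹ ^ (j + 1)) (x := x) hsymm (by positivity) (slidePrime k)
  set χ := defectiveColor nb k (pairCost w x) c with hχ
  have hval : ∀ e, (x e = 2⁻¹ ^ (j + 1) ∧ (roundStep nb k c w j x e = 2⁻¹ ^ j ∨
      roundStep nb k c w j x e = 0)) ∨
      (x e ≠ 2⁻¹ ^ (j + 1) ∧ roundStep nb k c w j x e = x e) := by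
    intro e
    by_cases he : x e = 2⁻¹ ^ (j + 1)
    · refine Or.inl ⟨he, ?_⟩
      have h2 : (2 : ℝ) * 2⁻¹ ^ (j + 1) = 2⁻¹ ^ j := by rw [pow_succ]; ring
      rw [← h2]
      exact sweep_of_lt (hlt e) he
    · exact Or.inr ⟨he, sweep_of_ne he⟩
  change _ ≤ ∑ e, w e * roundStep nb k c w j x e - (1 + j / k) / 2 * ∑ e, ∑ f ∈ nb e,
    (if χ f ≠ χ e then min (w e) (w f) else 0) *
      (roundStep nb k c w j x e * roundStep nb k c w j x f) at hobj
  set z := roundStep nb k c w j x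
  have hz0 : ∀ e, 0 ≤ z e := fun e => by
    rcases hval e with ⟨-, h | h⟩ | ⟨-, h⟩ <;> rw [h]
    · positivity
    · exact hx0 e
  have hz2 : ∀ e, z e ≤ 2 * x e := fun e => by
    rcases hval e with ⟨h1, h | h⟩ | ⟨-, h⟩ <;> rw [h]
    · rw [h1, pow_succ]
      linarith
    · linarith [hx0 e]
    · linarith [hx0 e]
  refine ⟨fun e => ?_, ?_⟩
  · rcases hval e with ⟨-, h | h⟩ | ⟨h1, h⟩
    · exact Or.inr ⟨j, le_rfl, h⟩
    · exact Or.inl h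
    · rw [h]
      rcases hx e with h2 | ⟨i, hi, h2⟩
      · exact Or.inl h2
      · exact Or.inr ⟨i, Nat.le_of_lt_succ (lt_of_le_of_ne hi fun h' => h1 (by rw [h2, h'])), h2⟩
  · have hsplit : ∀ y : E → ℝ, conflict nb w y = (∑ e, ∑ f ∈ nb e,
        (if χ f ≠ χ e then min (w e) (w f) else 0) * (y e * y f)) +
        ∑ e, ∑ f ∈ nb e, if χ f = χ e then pairCost w y e f else 0 := fun y => by
      simp only [conflict, ← sum_add_distrib]
      refine sum_congr rfl fun e _ => sum_congr rfl fun f _ => ?_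
      by_cases h : χ f = χ e <;> simp [h, pairCost]
    have hmono4 : (∑ e, ∑ f ∈ nb e, if χ f = χ e then pairCost w z e f else 0) ≤
        4 * ∑ e, ∑ f ∈ nb e, if χ f = χ e then pairCost w x e f else 0 := by
      simp only [mul_sum]
      refine sum_le_sum fun e _ => sum_le_sum fun f _ => ?_
      split_ifs
      · have h1 := mul_le_mul (hz2 e) (hz2 f) (hz0 f) (by linarith [hx0 e])
        have h2 := mul_le_mul_of_nonneg_left h1 (le_min (hw e) (hw f))
        simp only [pairCost]
        linarith
      · simp
    have hmono0 : 0 ≤ ∑ e, ∑ f ∈ nb e, if χ f = χ e then pairCost w x e f else 0 :=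
      sum_nonneg fun e _ => sum_nonneg fun f _ => by split_ifs <;> simp [hA]
    rw [hsplit z]
    have hcx := hsplit x
    have hcdef : conflict nb w x = ∑ e, ∑ f ∈ nb e, pairCost w x e f := rfl
    rw [← hcdef] at hmono
    set P := ∑ e, ∑ f ∈ nb e, (if χ f ≠ χ e then min (w e) (w f) else 0) * (x e * x f)
    set Q := ∑ e, ∑ f ∈ nb e, (if χ f ≠ χ e then min (w e) (w f) else 0) * (z e * z f)
    set m := ∑ e, ∑ f ∈ nb e, if χ f = χ e then pairCost w x e f else 0
    set m' := ∑ e, ∑ f ∈ nb e, if χ f = χ e then pairCost w z e f else 0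
    set S := conflict nb w x
    have hk' : (0 : ℝ) < k := by exact_mod_cast hk
    have hmu : (1 : ℝ) + j / k ≤ 2 := by
      have : (j : ℝ) / k ≤ 1 := (div_le_one hk').2 (by exact_mod_cast (by omega : j ≤ k))
      linarith
    have hmu0 : (0 : ℝ) ≤ 1 + j / k := by positivity
    have hS : m * 8 ≤ S / k := by
      rw [le_div_iff₀ hk']
      linarith
    -- The coefficient is at most 1 because `j ≤ k`; this is why the penalty may grow through all
    -- steps without exceeding a constant.
    have h4 : (1 + (j : ℝ) / k) / 2 * m' ≤ 4 * m := by
      have h5 : m' * ((1 + (j : ℝ) / k) / 2) ≤ 4 * m * 1 :=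
        mul_le_mul hmono4 (by linarith) (by positivity) (by linarith)
      linarith
    have h6 : (1 + ((j + 1 : ℕ) : ℝ) / k) / 2 * S = (1 + j / k) / 2 * S + S / k / 2 := by
      push_cast
      ring
    have h7 : (1 + (j : ℝ) / k) / 2 * P ≤ (1 + j / k) / 2 * S :=
      mul_le_mul_of_nonneg_left (by linarith) (by positivity)
    rw [h6, mul_add]
    linarith

theorem roundAll_spec [Fintype E] (hk : 0 < k) (hsymm : ∀ e f, f ∈ nb e → e ∈ nb f) (hw : ∀ e, 0 ≤ w e)
    (hc : ∀ e, c e < 2 ^ (4 * k)) (hne : ∀ e, ∀ f ∈ nb e, c f ≠ c e) {j : ℕ} (hj : j ≤ k)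
    {x : E → ℝ} (hx : IsDyadic j x) :
    IsDyadic 0 (roundAll nb k c w j x) ∧
      ∑ e, w e * x e - (1 + j / k) / 2 * conflict nb w x ≤
        ∑ e, w e * roundAll nb k c w j x e - 1 / 2 * conflict nb w (roundAll nb k c w j x) := by
  induction j generalizing x with
  | zero => exact ⟨hx, by simp [roundAll]⟩
  | succ j ih =>
    obtain ⟨h1, h2⟩ := roundStep_spec hk hsymm hw hc hne hj hx
    obtain ⟨h3, h4⟩ := ih (by omega) h1
    exact ⟨h3, h2.trans h4⟩

/-! ### Choosing an independent set -/

/-- The strict order, by weight and then by identifier, in which chosen neighbors compete. -/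
def Beats (w : E → ℝ) (ident : E → ℕ) (e f : E) : Prop :=
  w f < w e ∨ (w f = w e ∧ ident f < ident e)

/-- `e` has value `1` and beats all neighbors of value `1`. -/
def Chosen (nb : E → Finset E) (w : E → ℝ) (ident : E → ℕ) (x : E → ℝ) (e : E) : Prop :=
  x e = 1 ∧ ∀ f ∈ nb e, x f = 1 → Beats w ident e f

theorem Beats.asymm {ident : E → ℕ} {e f : E} (h : Beats w ident e f) : ¬ Beats w ident f e := by
  rintro (h' | h') <;> rcases h with h | h
  · exact lt_asymm h h'
  · exact h'.ne h.1.symm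
  · exact h.ne h'.1.symm
  · exact lt_asymm h.2 h'.2

theorem beats_or_beats {ident : E → ℕ} (hid : Function.Injective ident) {e f : E} (h : e ≠ f) :
    Beats w ident e f ∨ Beats w ident f e := by
  rcases lt_trichotomy (w e) (w f) with h1 | h1 | h1
  · exact Or.inr (Or.inl h1)
  · rcases lt_or_gt_of_ne (hid.ne h) with h2 | h2
    · exact Or.inr (Or.inr ⟨h1, h2⟩)
    · exact Or.inl (Or.inr ⟨h1.symm, h2⟩)
  · exact Or.inl (Or.inl h1)

theorem Beats.le {ident : E → ℕ} {e f : E} (h : Beats w ident e f) : w f ≤ w e :=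
  h.elim le_of_lt fun h => h.1.le

-- Each unordered pair is charged to its loser, whose weight is the minimum; the factor 2 accounts
-- for the two orders.
open Classical in
theorem conflict_eq [Fintype E] {ident : E → ℕ} (hsymm : ∀ e f, f ∈ nb e → e ∈ nb f)
    (hirr : ∀ e, e ∉ nb e) (hid : Function.Injective ident) (x : E → ℝ) :
    conflict nb w x =
      2 * ∑ e, ∑ f ∈ nb e, if Beats w ident f e then w e * (x e * x f) else 0 := by
  have h1 : ∀ e, ∀ f ∈ nb e, pairCost w x e f =
      (if Beats w ident f e then w e * (x e * x f) else 0) +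
        if Beats w ident e f then w f * (x f * x e) else 0 := by
    intro e f hf
    rcases beats_or_beats (w := w) hid (fun h : e = f => hirr e (h ▸ hf)) with h | h
    · rw [if_neg h.asymm, if_pos h, pairCost, min_eq_right h.le]
      ring
    · rw [if_neg h.asymm, if_pos h, pairCost, min_eq_left h.le, add_zero]
  rw [conflict, sum_congr rfl fun e _ => sum_congr rfl (h1 e)]
  simp only [sum_add_distrib]
  rw [two_mul]
  congr 1
  exact sum_nb_comm hsymm fun e f => if Beats w ident e f then w f * (x f * x e) else 0

-- An element of value 1 that is not chosen loses against a neighbor of value 1, so its weight is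
-- already covered by the term charged to it.
open Classical in
theorem le_sum_chosen [Fintype E] {ident : E → ℕ} (hsymm : ∀ e f, f ∈ nb e → e ∈ nb f)
    (hirr : ∀ e, e ∉ nb e) (hid : Function.Injective ident) (hw : ∀ e, 0 ≤ w e) {x : E → ℝ}
    (hx : IsDyadic 0 x) :
    ∑ e, w e * x e - 1 / 2 * conflict nb w x ≤
      ∑ e with Chosen nb w ident x e, w e := by
  rw [conflict_eq hsymm hirr hid, sub_le_iff_le_add, ← mul_assoc, sum_filter]
  norm_num only [one_mul]
  rw [← sum_add_distrib]
  refine sum_le_sum fun e _ => ?_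
  have hx0 := hx.nonneg
  have hnn : ∀ f ∈ nb e, 0 ≤ if Beats w ident f e then w e * (x e * x f) else 0 := fun f _ => by
    split_ifs
    · exact mul_nonneg (hw e) (mul_nonneg (hx0 e) (hx0 f))
    · exact le_rfl
  rcases hx e with he | ⟨i, hi, he⟩
  · rw [he, mul_zero]
    exact add_nonneg (by split_ifs <;> simp [hw]) (by simp)
  · obtain rfl : i = 0 := by omega
    rw [pow_zero] at he
    by_cases hch : Chosen nb w ident x e
    · rw [if_pos hch, he, mul_one]
      have := sum_nonneg hnn
      rw [he] at this
      linarith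
    · rw [if_neg hch]
      have : ∃ f ∈ nb e, x f = 1 ∧ ¬ Beats w ident e f := by
        by_contra! hcon
        exact hch ⟨he, hcon⟩
      obtain ⟨f, hf, hxf, hb⟩ := this
      have hb' := (beats_or_beats (w := w) hid fun h : e = f => hirr e (h ▸ hf)).resolve_left hb
      have := single_le_sum hnn hf
      rw [if_pos hb', hxf, mul_one] at this
      linarith

/-! ### The fractional solution -/

variable (nb)

/-- The total value of `e` and of its neighbors of the same weight. -/
noncomputable def load (w x : E → ℝ) (e : E) : ℝ :=
  x e + ∑ f ∈ nb e, if w f = w e then x f else 0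

/-- All values start at `2⁻¹ ^ K` and are doubled as long as the load is small. -/
noncomputable def doubling (w : E → ℝ) (K : ℕ) : ℕ → E → ℝ
  | 0 => fun _ => 2⁻¹ ^ K
  | s + 1 => fun e =>
    if load nb w (doubling w K s) e < 1 / 32 then 2 * doubling w K s e else doubling w K s e

variable {nb} {K : ℕ}

theorem doubling_succ (s : ℕ) (e : E) : doubling nb w K (s + 1) e =
    if load nb w (doubling nb w K s) e < 1 / 32 then 2 * doubling nb w K s e
    else doubling nb w K s e :=
  rfl

theorem load_mono {x y : E → ℝ} (h : ∀ e, x e ≤ y e) (e : E) : load nb w x e ≤ load nb w y e :=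
  add_le_add (h e) (sum_le_sum fun f _ => by split_ifs <;> simp [h])

theorem le_load {x : E → ℝ} (h : ∀ e, 0 ≤ x e) (e : E) : x e ≤ load nb w x e :=
  le_add_of_nonneg_right (sum_nonneg fun f _ => by split_ifs <;> simp [h])

theorem doubling_isDyadic (s : ℕ) (e : E) : ∃ i ≤ K, doubling nb w K s e = 2⁻¹ ^ i := by
  induction s generalizing e with
  | zero => exact ⟨K, le_rfl, rfl⟩
  | succ s ih =>
    have h0 : ∀ e, 0 ≤ doubling nb w K s e := fun e => by
      obtain ⟨i, -, h⟩ := ih e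
      rw [h]
      positivity
    obtain ⟨i, hi, h⟩ := ih e
    rw [doubling_succ]
    split_ifs with hl
    · have := (le_load h0 e).trans_lt hl
      rw [h] at this ⊢
      -- Doubling cannot exceed 1: a value that still doubles is at most its load, hence below `1 /
      -- 32`.
      cases i with
      | zero => norm_num at this
      | succ i => exact ⟨i, by omega, by rw [pow_succ]; ring⟩
    · exact ⟨i, hi, h⟩

theorem doubling_nonneg (s : ℕ) (e : E) : 0 ≤ doubling nb w K s e := by
  obtain ⟨i, -, h⟩ := doubling_isDyadic (nb := nb) (w := w) (K := K) s e
  rw [h]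
  positivity

theorem doubling_le_succ (s : ℕ) (e : E) :
    doubling nb w K s e ≤ doubling nb w K (s + 1) e := by
  have := doubling_nonneg (nb := nb) (w := w) (K := K) s e
  rw [doubling_succ]
  split_ifs <;> linarith

/-- Loads only grow. A small final load would mean doubling in all `K` steps, up to the value 1,
which alone exceeds the threshold. -/
theorem le_load_doubling (e : E) : 1 / 32 ≤ load nb w (doubling nb w K K) e := by
  by_contra! hcon
  have h : ∀ s ≤ K, doubling nb w K s e = 2⁻¹ ^ (K - s) := by
    intro s hs
    induction s with
    | zero => rfl
    | succ s ih =>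
      have hl : load nb w (doubling nb w K s) e < 1 / 32 := by
        refine lt_of_le_of_lt (load_mono (fun f => ?_) e) hcon
        exact monotone_nat_of_le_succ (f := fun s => doubling nb w K s f)
          (fun s => doubling_le_succ s f) (by omega)
      rw [doubling_succ, if_pos hl, ih (by omega), show K - s = K - (s + 1) + 1 by omega, pow_succ]
      ring
  have h1 := (le_load (w := w) (doubling_nonneg (nb := nb) (w := w) (K := K) K) e).trans_lt hcon
  rw [h K le_rfl] at h1
  norm_num at h1

/-- If some member of the clique doubles, its load bounds the whole sum by `1 / 32` beforehand, and
one step at most doubles it. Otherwise nothing changes. -/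
theorem sum_doubling_le {Q : Finset E} (hQ : ∀ e ∈ Q, ∀ f ∈ Q, f ≠ e → f ∈ nb e)
    (hcard : 16 * Q.card ≤ 2 ^ K) {ω : ℝ} (hω : ∀ e ∈ Q, w e = ω) (s : ℕ) :
    ∑ e ∈ Q, doubling nb w K s e ≤ 1 / 16 := by
  classical
  induction s with
  | zero =>
    simp only [doubling, sum_const, nsmul_eq_mul]
    have : (16 * Q.card : ℝ) ≤ 2 ^ K := by exact_mod_cast hcard
    rw [inv_pow, ← div_eq_mul_inv, div_le_iff₀ (by positivity)]
    linarith
  | succ s ih =>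
    by_cases h : ∃ e ∈ Q, load nb w (doubling nb w K s) e < 1 / 32
    · obtain ⟨e, he, hl⟩ := h
      have h0 := doubling_nonneg (nb := nb) (w := w) (K := K) s
      have h1 : ∑ f ∈ Q, doubling nb w K s f ≤ load nb w (doubling nb w K s) e := by
        rw [← add_sum_erase Q _ he, load]
        refine add_le_add le_rfl ?_
        rw [← sum_filter]
        refine sum_le_sum_of_subset_of_nonneg (fun f hf => ?_) fun f _ _ => h0 f
        rw [mem_erase] at hf
        rw [mem_filter]
        exact ⟨hQ e he f hf.2 hf.1, (hω f hf.2).trans (hω e he).symm⟩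
      have h2 : ∑ f ∈ Q, doubling nb w K (s + 1) f ≤ ∑ f ∈ Q, 2 * doubling nb w K s f :=
        sum_le_sum fun f _ => by
          have := h0 f
          rw [doubling_succ]
          split_ifs <;> linarith
      rw [← mul_sum] at h2
      linarith
    · refine (sum_le_sum fun f hf => ?_).trans ih
      rw [doubling_succ, if_neg fun hl => h ⟨f, hf, hl⟩]

theorem sum_le_of_geometric {W : ℝ} (hW : 0 ≤ W) (T : Finset ℝ)
    (hT : ∀ ω ∈ T, ω = 0 ∨ ∃ n : ℕ, ω = W * (1 / 2) ^ n) : ∑ ω ∈ T, ω ≤ W * 2 := by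
  classical
  have h : ∀ ω ∈ T.filter (· ≠ 0), ∃ n : ℕ, ω = W * (1 / 2) ^ n := fun ω hω =>
    (hT ω (mem_filter.1 hω).1).resolve_left (mem_filter.1 hω).2
  choose! n hn using h
  rw [← sum_filter_ne_zero T]
  calc ∑ ω ∈ T with ω ≠ 0, ω = ∑ ω ∈ T with ω ≠ 0, W * (1 / 2) ^ n ω := sum_congr rfl hn
    _ = ∑ i ∈ (T.filter (· ≠ 0)).image n, W * (1 / 2) ^ i := by
      rw [sum_image]
      intro a ha b hb hab
      rw [hn a ha, hn b hb, hab]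
    _ ≤ W * 2 := by
      rw [← mul_sum]
      refine mul_le_mul_of_nonneg_left ?_ hW
      exact (summable_geometric_two.sum_le_tsum _ fun i _ => by positivity).trans_eq
        tsum_geometric_two

/-- The weight classes are powers of two up to `w g`, so a bound of `1 / 16` per class sums
geometrically to `2 * w g / 16`. This is what the rounding of the weights is for. -/
theorem sum_mul_le_of_classes {s : Finset E} {x : E → ℝ} (hw : ∀ e, w e = 0 ∨ ∃ z : ℤ, w e = 2 ^ z)
    (hcl : ∀ ω, ∑ e ∈ s with w e = ω, x e ≤ 1 / 16) {g : E} (hle : ∀ e ∈ s, w e ≤ w g) :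
    ∑ e ∈ s, w e * x e ≤ w g / 8 := by
  classical
  have hw0 : ∀ e, 0 ≤ w e := fun e => by
    rcases hw e with h | ⟨z, h⟩ <;> rw [h]
    positivity
  have h1 : ∑ ω ∈ s.image w, ω ≤ w g * 2 := by
    refine sum_le_of_geometric (hw0 g) _ fun ω hω => ?_
    obtain ⟨e, he, rfl⟩ := mem_image.1 hω
    have hle := hle e he
    rcases hw e with h | ⟨z, h⟩
    · exact Or.inl h
    · rcases hw g with h' | ⟨z', h'⟩
      · exact Or.inl (le_antisymm (h' ▸ hle) (hw0 e))
      · rw [h, h'] at hle ⊢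
        have hz : z ≤ z' := (zpow_le_zpow_iff_right₀ one_lt_two).1 hle
        refine Or.inr ⟨(z' - z).toNat, ?_⟩
        rw [one_div, inv_pow, ← zpow_natCast, Int.toNat_of_nonneg (by omega), ← zpow_neg,
          ← zpow_add₀ two_ne_zero]
        congr 1
        ring
  rw [← sum_fiberwise_of_maps_to (t := s.image w) (g := w) fun e he => mem_image_of_mem w he]
  calc ∑ ω ∈ s.image w, ∑ e ∈ s with w e = ω, w e * x e
      ≤ ∑ ω ∈ s.image w, ω * (1 / 16) := by
        refine sum_le_sum fun ω hω => ?_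
        obtain ⟨g, -, hg⟩ := mem_image.1 hω
        refine le_trans (le_of_eq ?_) (mul_le_mul_of_nonneg_left (hcl ω) (hg ▸ hw0 g))
        rw [mul_sum]
        exact sum_congr rfl fun e he => by rw [(mem_filter.1 he).2]
    _ ≤ w g / 8 := by
      rw [← sum_mul]
      linarith

/-- The neighbors of each element are covered by two small cliques. -/
def TwoCliques (nb : E → Finset E) (K : ℕ) : Prop :=
  ∀ e, ∃ Q : Fin 2 → Finset E, (∀ f ∈ nb e, ∃ i, f ∈ Q i) ∧
    ∀ i, 16 * (Q i).card ≤ 2 ^ K ∧ ∀ f ∈ Q i, ∀ g ∈ Q i, g ≠ f → g ∈ nb f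

theorem conflict_doubling_le [Fintype E] {ident : E → ℕ} (hsymm : ∀ e f, f ∈ nb e → e ∈ nb f)
    (hirr : ∀ e, e ∉ nb e) (hid : Function.Injective ident)
    (hw : ∀ e, w e = 0 ∨ ∃ z : ℤ, w e = 2 ^ z) (hQ : TwoCliques nb K) :
    conflict nb w (doubling nb w K K) ≤ 1 / 2 * ∑ e, w e * doubling nb w K K e := by
  classical
  have hw0 : ∀ e, 0 ≤ w e := fun e => by
    rcases hw e with h | ⟨z, h⟩ <;> rw [h]
    positivity
  set x := doubling nb w K K
  have hx0 : ∀ e, 0 ≤ x e := doubling_nonneg K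
  -- After the exchange, pairs are grouped by their winner `e`. Its lighter neighbors lie in two
  -- cliques contributing `w e / 8` each, and the factor 2 of `conflict_eq` makes this `w e / 2`.
  rw [conflict_eq (ident := ident) hsymm hirr hid, sum_nb_comm hsymm, mul_sum, mul_sum]
  refine sum_le_sum fun e _ => ?_
  obtain ⟨Q, hcov, hQ⟩ := hQ e
  have h1 : ∀ i, ∑ f ∈ (Q i) with w f ≤ w e, w f * x f ≤ w e / 8 := by
    intro i
    refine sum_mul_le_of_classes hw (fun ω => ?_) fun f hf => (mem_filter.1 hf).2
    refine sum_doubling_le (fun f hf g hg hne => ?_) ?_ (fun f hf => (mem_filter.1 hf).2) K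
    · exact (hQ i).2 f (mem_filter.1 (mem_filter.1 hf).1).1 g (mem_filter.1 (mem_filter.1 hg).1).1
        hne
    · refine le_trans (Nat.mul_le_mul_left _ (card_le_card ?_)) (hQ i).1
      exact (filter_subset _ _).trans (filter_subset _ _)
  have h2 : ∑ f ∈ nb e with w f ≤ w e, w f * x f ≤ w e / 8 + w e / 8 := by
    refine le_trans ?_ (add_le_add (h1 0) (h1 1))
    rw [← sum_union_inter]
    refine le_trans ?_ (le_add_of_nonneg_right
      (sum_nonneg fun f _ => mul_nonneg (hw0 f) (hx0 f)))
    refine sum_le_sum_of_subset_of_nonneg (fun f hf => ?_)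
      fun f _ _ => mul_nonneg (hw0 f) (hx0 f)
    rw [mem_filter] at hf
    obtain ⟨i, hi⟩ := hcov f hf.1
    rw [mem_union, mem_filter, mem_filter]
    fin_cases i
    · exact Or.inl ⟨hi, hf.2⟩
    · exact Or.inr ⟨hi, hf.2⟩
  have h3 : ∑ f ∈ nb e, (if Beats w ident e f then w f * (x f * x e) else 0) ≤
      x e * ∑ f ∈ nb e with w f ≤ w e, w f * x f := by
    rw [mul_sum, sum_filter]
    refine sum_le_sum fun f _ => ?_
    have := mul_nonneg (hw0 f) (mul_nonneg (hx0 f) (hx0 e))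
    split_ifs with a b b
    · exact le_of_eq (by ring)
    · exact absurd a.le b
    · linarith
    · exact le_rfl
  have h4 := mul_le_mul_of_nonneg_left h2 (hx0 e)
  linarith

/-- Each member of `M` has load at least `1 / 32` from elements of its own weight, and each element
is counted for at most two members: `32 * 2 = 64`. -/
theorem sum_le_doubling [Fintype E] (hw0 : ∀ e, 0 ≤ w e) (hsymm : ∀ e f, f ∈ nb e → e ∈ nb f)
    (hirr : ∀ e, e ∉ nb e)
    [DecidableEq E] {M : Finset E}
    (hM : ∀ e, (M.filter fun f => f = e ∨ f ∈ nb e).card ≤ 2) :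
    ∑ e ∈ M, w e ≤ 64 * ∑ e, w e * doubling nb w K K e := by
  set x := doubling nb w K K
  have hx0 : ∀ e, 0 ≤ x e := doubling_nonneg K
  calc ∑ e ∈ M, w e ≤ ∑ e ∈ M, 32 * ∑ f, if e = f ∨ e ∈ nb f then w f * x f else 0 := by
        refine sum_le_sum fun e _ => ?_
        have h1 := mul_le_mul_of_nonneg_left (le_load_doubling (nb := nb) (w := w) (K := K) e)
          (hw0 e)
        have h2 : w e * load nb w x e ≤ ∑ f, if e = f ∨ e ∈ nb f then w f * x f else 0 := by
          have h3 : ∑ f ∈ nb e, w e * (if w f = w e then x f else 0) ≤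
              ∑ f ∈ (univ.erase e), if e = f ∨ e ∈ nb f then w f * x f else 0 := by
            have hmem : ∀ f, 0 ≤ if e = f ∨ e ∈ nb f then w f * x f else 0 := fun f => by
              split_ifs
              · exact mul_nonneg (hw0 f) (hx0 f)
              · exact le_rfl
            refine le_trans (sum_le_sum fun f hf => ?_) (sum_le_sum_of_subset_of_nonneg
              (fun f hf => mem_erase.2 ⟨fun h => hirr e (h ▸ hf), mem_univ f⟩) fun f _ _ => hmem f)
            rw [if_pos (Or.inr (hsymm e f hf))]
            split_ifs with h
            · rw [h]
            · rw [mul_zero]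
              exact mul_nonneg (hw0 f) (hx0 f)
          rw [load, mul_add, mul_sum, ← add_sum_erase univ _ (mem_univ e), if_pos (Or.inl rfl)]
          exact add_le_add le_rfl h3
        linarith
    _ = 32 * ∑ f, ∑ e ∈ M, if e = f ∨ e ∈ nb f then w f * x f else 0 := by
        rw [← mul_sum, sum_comm]
    _ ≤ 32 * ∑ f, 2 * (w f * x f) := by
        refine mul_le_mul_of_nonneg_left (sum_le_sum fun f _ => ?_) (by norm_num)
        rw [← sum_filter, sum_const, nsmul_eq_mul]
        exact mul_le_mul_of_nonneg_right (by exact_mod_cast hM f) (mul_nonneg (hw0 f) (hx0 f))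
    _ = 64 * ∑ e, w e * x e := by rw [← mul_sum]; ring

end

/-! ### The independent set that is computed and its guarantee -/

section

variable {E : Type} (nb : E → Finset E)

/-- The independent set that is computed: fractional solution, rounding, local maxima. -/
noncomputable def Selected (K : ℕ) (ident : E → ℕ) (w : E → ℝ) : E → Prop :=
  Chosen nb w ident
    (roundAll nb (K + 4) (baseColor nb (K + 4) ident) w K (doubling nb w K K))

variable {nb} {K : ℕ} {ident : E → ℕ} {w : E → ℝ}

theorem Selected.not_mem (hsymm : ∀ e f, f ∈ nb e → e ∈ nb f) {e f : E}
    (he : Selected nb K ident w e) (hf : Selected nb K ident w f) : f ∉ nb e := fun h =>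
  (he.2 f h hf.1).asymm (hf.2 e (hsymm e f h) he.1)

theorem TwoCliques.card_le (h : TwoCliques nb K) (e : E) : (nb e).card ≤ 2 ^ K := by
  classical
  obtain ⟨Q, hcov, hQ⟩ := h e
  have h1 : nb e ⊆ Q 0 ∪ Q 1 := fun f hf => by
    obtain ⟨i, hi⟩ := hcov f hf
    rw [mem_union]
    fin_cases i
    · exact Or.inl hi
    · exact Or.inr hi
  have h2 := (Finset.card_le_card h1).trans (card_union_le _ _)
  have h3 := (hQ 0).1
  have h4 := (hQ 1).1
  omega

open Classical in
theorem sum_le_selected [Fintype E] (hsymm : ∀ e f, f ∈ nb e → e ∈ nb f) (hirr : ∀ e, e ∉ nb e)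
    (hid : Function.Injective ident) (hw : ∀ e, w e = 0 ∨ ∃ z : ℤ, w e = 2 ^ z)
    (hQ : TwoCliques nb K) {M : Finset E}
    (hM : ∀ e, (M.filter fun f => f = e ∨ f ∈ nb e).card ≤ 2) :
    ∑ e ∈ M, w e ≤ 128 * ∑ e with Selected nb K ident w e, w e := by
  have hw0 : ∀ e, 0 ≤ w e := fun e => by
    rcases hw e with h | ⟨z, h⟩ <;> rw [h]
    positivity
  obtain ⟨hc, hne⟩ := baseColor_spec (k := K + 4) le_rfl hsymm hirr hid hQ.card_le
  have hdy : IsDyadic K (doubling nb w K K) := fun e => Or.inr (doubling_isDyadic K e)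
  obtain ⟨hx, hobj⟩ := roundAll_spec (k := K + 4) (by omega) hsymm hw0 hc hne (by omega) hdy
  have h1 := le_sum_chosen hsymm hirr hid hw0 hx
  have h2 := conflict_doubling_le hsymm hirr hid hw hQ
  have h3 := sum_le_doubling (K := K) hw0 hsymm hirr hM
  -- With coefficient at most 1, the initial objective keeps half of the fractional weight, which
  -- turns 64 into 128.
  have h4 : (1 + (K : ℝ) / (K + 4 : ℕ)) / 2 * conflict nb w (doubling nb w K K) ≤
      1 * conflict nb w (doubling nb w K K) := by
    refine mul_le_mul_of_nonneg_right ?_ (sum_nonneg fun e _ => sum_nonneg fun f _ =>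
      mul_nonneg (le_min (hw0 e) (hw0 f)) (mul_nonneg (hdy.nonneg e) (hdy.nonneg f)))
    have : (K : ℝ) / (K + 4 : ℕ) ≤ 1 := (div_le_one (by positivity)).2 (by push_cast; linarith)
    linarith
  have h5 : ∑ e with Chosen nb w ident (roundAll nb (K + 4) (baseColor nb (K + 4) ident) w K
      (doubling nb w K K)) e, w e = ∑ e with Selected nb K ident w e, w e := rfl
  rw [h5] at h1
  linarith

end

/-! ### Views and locality -/

/-- All that a node can learn: its own input, and in each round the views of its neighbors together
with the ports through which they see it. -/
inductive View : Type
  | start (ident : ℕ) (L : ℝ) (d : ℕ) (w : Fin d → ℝ) : View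
  | round (prev : View) (inbox : ℕ → Option (View × ℕ)) : View

theorem View.start_inj {i i' : ℕ} {L L' : ℝ} {d d' : ℕ} {w : Fin d → ℝ} {w' : Fin d' → ℝ}
    (h : View.start i L d w = View.start i' L' d' w') :
    i = i' ∧ L = L' ∧ d = d' ∧ ∀ (p : Fin d) (p' : Fin d'), (p : ℕ) = p' → w p = w' p' := by
  cases h
  exact ⟨rfl, rfl, rfl, fun p p' h => congrArg w (Fin.ext h)⟩

/-- The number of rounds that a view records. -/
def View.depth : View → ℕ
  | .start _ _ _ _ => 0
  | .round v _ => v.depth + 1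

/-- The algorithm whose messages contain everything that is known, with outputs given by `out`. -/
def fullInformation (out : View → Option (Option ℕ)) : LocalAlgorithm where
  State := View
  Msg := View × ℕ
  init := View.start
  send s p := (s, p)
  receive := View.round
  output := out

/-- A network together with its graph and with the number known to all nodes. -/
structure Net : Type 1 where
  V : Type
  fintype : Fintype V
  G : SimpleGraph V
  dec : DecidableRel G.Adj
  N : Network G
  L : ℝ

namespace Net

attribute [instance] Net.fintype Net.dec

/-- The edges. -/
abbrev Edge (X : Net) : Type := X.G.edgeSet

/-- The degree of a node. -/
abbrev deg (X : Net) (v : X.V) : ℕ := X.G.degree v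

/-- The neighbor at a port. -/
def nbr (X : Net) (v : X.V) (p : Fin (X.deg v)) : X.V := (X.N.port v).symm p

theorem adj_nbr (X : Net) (v : X.V) (p : Fin (X.deg v)) : X.G.Adj v (X.nbr v p) :=
  ((X.N.port v).symm p).2

/-- The port through which the neighbor at a port sees the node. -/
def back (X : Net) (v : X.V) (p : Fin (X.deg v)) : Fin (X.deg (X.nbr v p)) :=
  X.N.port (X.nbr v p) ⟨v, (X.adj_nbr v p).symm⟩

theorem nbr_back (X : Net) (v : X.V) (p : Fin (X.deg v)) : X.nbr (X.nbr v p) (X.back v p) = v :=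
  congrArg Subtype.val ((X.N.port (X.nbr v p)).symm_apply_apply ⟨v, (X.adj_nbr v p).symm⟩)

/-- The edge at a port. -/
def edge (X : Net) (v : X.V) (p : Fin (X.deg v)) : X.Edge := ⟨s(v, X.nbr v p), X.adj_nbr v p⟩

theorem edge_back (X : Net) (v : X.V) (p : Fin (X.deg v)) :
    X.edge (X.nbr v p) (X.back v p) = X.edge v p := by
  refine Subtype.ext ?_
  change s(X.nbr v p, X.nbr (X.nbr v p) (X.back v p)) = s(v, X.nbr v p)
  rw [nbr_back, Sym2.eq_swap]

theorem edge_injective (X : Net) (v : X.V) : Function.Injective (X.edge v) := fun p q h => by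
  have h1 : s(v, X.nbr v p) = s(v, X.nbr v q) := congrArg Subtype.val h
  rw [Sym2.congr_right] at h1
  exact (X.N.port v).symm.injective (Subtype.ext h1)

theorem mem_edge {X : Net} {v : X.V} {e : X.Edge} : v ∈ e.1 ↔ ∃ p, X.edge v p = e := by
  constructor
  · intro h
    obtain ⟨⟨u, hu⟩⟩ : Nonempty {u // s(v, u) = e.1} := ⟨⟨_, Sym2.other_spec h⟩⟩
    have hadj : X.G.Adj v u := by
      have := e.2
      rwa [← hu] at this
    refine ⟨X.N.port v ⟨u, hadj⟩, Subtype.ext ?_⟩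
    change s(v, X.nbr v _) = e.1
    rw [← hu, nbr, Equiv.symm_apply_apply]
  · rintro ⟨p, rfl⟩
    exact Sym2.mem_mk_left _ _

theorem exists_edge_eq {X : Net} (e : X.Edge) : ∃ v p, X.edge v p = e := by
  obtain ⟨⟨a, b⟩, he⟩ := e
  exact ⟨a, mem_edge.1 (Sym2.mem_mk_left a b)⟩

noncomputable instance (X : Net) : Fintype X.Edge := Fintype.ofFinite _

open Classical in
/-- The edges that share a node with `e`. -/
noncomputable def nb (X : Net) (e : X.Edge) : Finset X.Edge :=
  univ.filter fun f => f ≠ e ∧ ∃ v, v ∈ e.1 ∧ v ∈ f.1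

theorem mem_nb {X : Net} {e f : X.Edge} : f ∈ X.nb e ↔ f ≠ e ∧ ∃ v, v ∈ e.1 ∧ v ∈ f.1 := by
  simp [nb]

theorem nb_symm {X : Net} (e f : X.Edge) (h : f ∈ X.nb e) : e ∈ X.nb f := by
  rw [mem_nb] at h ⊢
  obtain ⟨h1, v, h2, h3⟩ := h
  exact ⟨h1.symm, v, h3, h2⟩

theorem not_mem_nb {X : Net} (e : X.Edge) : e ∉ X.nb e := fun h => (mem_nb.1 h).1 rfl

/-- Splitting the neighbors of an edge by endpoint turns the sum into two sums over ports, the form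
in which a node reads it from its own and one neighbor's view. -/
theorem sum_nb {X : Net} {β : Type*} [AddCommMonoid β] (φ : X.Edge → β) (v : X.V)
    (p : Fin (X.deg v)) :
    ∑ f ∈ X.nb (X.edge v p), φ f = (∑ q, if q = p then 0 else φ (X.edge v q)) +
      ∑ q, if q = X.back v p then 0 else φ (X.edge (X.nbr v p) q) := by
  classical
  have hnb : X.nb (X.edge v p) = ((univ.erase p).image (X.edge v)) ∪
      ((univ.erase (X.back v p)).image (X.edge (X.nbr v p))) := by
    ext f
    simp only [mem_nb, mem_union, mem_image, mem_erase, mem_univ, and_true]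
    constructor
    · rintro ⟨hne, u, hu, hf⟩
      obtain ⟨q, rfl⟩ := mem_edge.1 hf
      rcases Sym2.mem_iff.1 hu with rfl | rfl
      · exact Or.inl ⟨q, fun h => hne (by rw [h]), rfl⟩
      · exact Or.inr ⟨q, fun h => hne (by rw [h, edge_back]), rfl⟩
    · rintro (⟨q, hq, rfl⟩ | ⟨q, hq, rfl⟩)
      · exact ⟨fun h => hq (X.edge_injective v h), v, Sym2.mem_mk_left _ _, Sym2.mem_mk_left _ _⟩
      · refine ⟨fun h => hq ?_, X.nbr v p, Sym2.mem_mk_right _ _, Sym2.mem_mk_left _ _⟩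
        exact X.edge_injective _ (h.trans (X.edge_back v p).symm)
  have hdisj : Disjoint ((univ.erase p).image (X.edge v))
      ((univ.erase (X.back v p)).image (X.edge (X.nbr v p))) := by
    rw [disjoint_left]
    intro f hf hf'
    obtain ⟨q, hq, rfl⟩ := mem_image.1 hf
    obtain ⟨q', hq', h⟩ := mem_image.1 hf'
    have hmem : X.nbr v p ∈ (X.edge v q).1 := h ▸ Sym2.mem_mk_left _ _
    rcases Sym2.mem_iff.1 hmem with h1 | h1
    · exact (X.adj_nbr v p).ne h1.symm
    · refine (mem_erase.1 hq).1 ((X.N.port v).symm.injective (Subtype.ext h1.symm))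
  have hsum : ∀ (u : X.V) (r : Fin (X.deg u)),
      ∑ f ∈ (univ.erase r).image (X.edge u), φ f = ∑ q, if q = r then 0 else φ (X.edge u q) := by
    intro u r
    rw [sum_image fun a _ b _ h => X.edge_injective u h,
      ← add_sum_erase univ (fun q => if q = r then 0 else φ (X.edge u q)) (mem_univ r), if_pos rfl,
      zero_add]
    exact sum_congr rfl fun q hq => by rw [if_neg (mem_erase.1 hq).1]
  rw [hnb, sum_union hdisj, hsum, hsum]

/-- What a node knows after `t` rounds. -/
def view (X : Net) : ℕ → X.V → View :=
  (fullInformation fun _ => none).run X.N X.L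

theorem run_fullInformation (X : Net) (out : View → Option (Option ℕ)) (t : ℕ) (v : X.V) :
    (fullInformation out).run X.N X.L t v = X.view t v := by
  induction t generalizing v with
  | zero => rfl
  | succ t ih =>
    rw [view, LocalAlgorithm.run, LocalAlgorithm.run]
    change View.round _ _ = View.round _ _
    rw [ih]
    refine congrArg _ (funext fun p => ?_)
    split_ifs
    · simp only [ih]
      rfl
    · rfl

theorem view_succ (X : Net) (t : ℕ) (v : X.V) : X.view (t + 1) v = View.round (X.view t v) fun p =>
    if h : p < X.deg v then some (X.view t (X.nbr v ⟨p, h⟩), (X.back v ⟨p, h⟩ : ℕ)) else none :=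
  rfl

theorem depth_view (X : Net) (t : ℕ) (v : X.V) : (X.view t v).depth = t := by
  induction t with
  | zero => rfl
  | succ t ih => rw [view_succ, View.depth, ih]

section

variable {X Y : Net} {t s : ℕ} {v : X.V} {v' : Y.V}

theorem view_eq_of_le (h : X.view t v = Y.view t v') (hs : s ≤ t) :
    X.view s v = Y.view s v' := by
  induction t, hs using Nat.le_induction with
  | base => exact h
  | succ t _ ih =>
    rw [view_succ, view_succ] at h
    exact ih (View.round.inj h).1

theorem start_eq_of_view_eq (h : X.view t v = Y.view t v') :
    X.N.id v = Y.N.id v' ∧ X.L = Y.L ∧ X.deg v = Y.deg v' ∧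
      ∀ (p : Fin (X.deg v)) (p' : Fin (Y.deg v')), (p : ℕ) = p' →
        X.N.weight (X.edge v p).1 = Y.N.weight (Y.edge v' p').1 :=
  View.start_inj (view_eq_of_le h (Nat.zero_le t))

theorem nbr_eq_of_view_eq (h : X.view (t + 1) v = Y.view (t + 1) v') {p : Fin (X.deg v)}
    {p' : Fin (Y.deg v')} (hp : (p : ℕ) = p') :
    X.view t (X.nbr v p) = Y.view t (Y.nbr v' p') ∧ (X.back v p : ℕ) = Y.back v' p' := by
  rw [view_succ, view_succ] at h
  have h1 := congrFun (View.round.inj h).2 p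
  rw [dif_pos p.2, dif_pos (hp ▸ p'.2)] at h1
  obtain ⟨h2, h3⟩ := Prod.mk.inj (Option.some.inj h1)
  have hp' : (⟨p, hp ▸ p'.2⟩ : Fin (Y.deg v')) = p' := Fin.ext hp
  rw [hp'] at h2 h3
  exact ⟨h2, h3⟩

end

end Net

/-- The label that `g` gives to an edge of `X` is determined by the view that either endpoint has
after `t` rounds, among all edges of all networks. -/
def LocalAt (X : Net) (t : ℕ) {α : Type*} (g : ∀ Y : Net, Y.Edge → α) : Prop :=
  ∀ (Y : Net) (v : X.V) (v' : Y.V) (p : Fin (X.deg v)) (p' : Fin (Y.deg v')),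
    X.view t v = Y.view t v' → (p : ℕ) = p' → g X (X.edge v p) = g Y (Y.edge v' p')

namespace LocalAt

variable {X : Net} {t : ℕ} {α β γ : Type*} {g : ∀ Y : Net, Y.Edge → α} {h : ∀ Y : Net, Y.Edge → β}

theorem mono (hg : LocalAt X t g) {t' : ℕ} (ht : t ≤ t') : LocalAt X t' g :=
  fun Y v v' p p' hv hp => hg Y v v' p p' (Net.view_eq_of_le hv ht) hp

theorem map (hg : LocalAt X t g) (F : α → β) : LocalAt X t fun Y e => F (g Y e) :=
  fun Y v v' p p' hv hp => congrArg F (hg Y v v' p p' hv hp)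

theorem prod (hg : LocalAt X t g) (hh : LocalAt X t h) : LocalAt X t fun Y e => (g Y e, h Y e) :=
  fun Y v v' p p' hv hp => Prod.ext (hg Y v v' p p' hv hp) (hh Y v v' p p' hv hp)

theorem pi {ι : Type*} {g : ∀ Y : Net, Y.Edge → ι → α} (hg : ∀ i, LocalAt X t fun Y e => g Y e i) :
    LocalAt X t g :=
  fun Y v v' p p' hv hp => funext fun i => hg i Y v v' p p' hv hp

/-- One more round reveals the view of the other endpoint. Equal views have equal degrees, so the
sums over ports match term by term. -/
theorem sum [AddCommMonoid β] (hg : LocalAt X t g) (φ : α → α → β) :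
    LocalAt X (t + 1) fun Y e => ∑ f ∈ Y.nb e, φ (g Y e) (g Y f) := by
  intro Y v v' p p' hv hp
  have hv0 := Net.view_eq_of_le hv (Nat.le_succ t)
  obtain ⟨hn, hb⟩ := Net.nbr_eq_of_view_eq hv hp
  have key : ∀ (u : X.V) (u' : Y.V) (r : Fin (X.deg u)) (r' : Fin (Y.deg u')),
      X.view t u = Y.view t u' → (r : ℕ) = r' →
      (∑ q, if q = r then 0 else φ (g X (X.edge v p)) (g X (X.edge u q))) =
        ∑ q, if q = r' then 0 else φ (g Y (Y.edge v' p')) (g Y (Y.edge u' q)) := by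
    intro u u' r r' hu hr
    refine Fintype.sum_equiv (finCongr (Net.start_eq_of_view_eq hu).2.2.1) _ _ fun q => ?_
    have h1 : q = r ↔ finCongr (Net.start_eq_of_view_eq hu).2.2.1 q = r' := by
      rw [Fin.ext_iff, Fin.ext_iff, hr]
      rfl
    rw [if_congr h1 rfl rfl, hg Y v v' p p' hv0 hp,
      hg Y u u' q (finCongr (Net.start_eq_of_view_eq hu).2.2.1 q) hu rfl]
  simp only [Net.sum_nb]
  rw [key v v' p p' hv0 hp, key _ _ _ _ hn hb]

theorem all (hg : LocalAt X t g) (P : α → α → Prop) :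
    LocalAt X (t + 1) fun Y e => ∀ f ∈ Y.nb e, P (g Y e) (g Y f) := by
  classical
  have h1 := (hg.sum fun a b => if P a b then 0 else 1).map fun n : ℕ => n = 0
  have h2 : (fun (Y : Net) (e : Y.Edge) => ∀ f ∈ Y.nb e, P (g Y e) (g Y f)) = fun Y e =>
      (∑ f ∈ Y.nb e, if P (g Y e) (g Y f) then 0 else 1) = 0 := by
    funext Y e
    simp
  rw [h2]
  exact h1

end LocalAt

/-! ### Edge identifiers, rounded weights, and the locality of each stage -/

/-- A canonical code for an unordered pair. -/
def pairCode : Sym2 ℕ → ℕ :=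
  Sym2.lift ⟨fun a b => Nat.pair (min a b) (max a b), fun a b => by
    simp only [min_comm, max_comm]⟩

theorem pairCode_injective : Function.Injective pairCode := by
  intro x y
  induction x with | _ a b => ?_
  induction y with | _ c d => ?_
  intro h
  have h1 := Nat.pair_eq_pair.1 h
  rw [Sym2.eq_iff]
  omega

theorem pairCode_lt {a b m : ℕ} (ha : a ≤ m) (hb : b ≤ m) : pairCode s(a, b) < (m + 1) ^ 2 := by
  refine (Nat.pair_lt_max_add_one_sq _ _).trans_le (Nat.pow_le_pow_left ?_ 2)
  omega

/-- A nonnegative weight, rounded down to a power of two. -/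
noncomputable def roundedWeight (r : ℝ) : ℝ := if r = 0 then 0 else 2 ^ Int.log 2 r

theorem roundedWeight_eq (r : ℝ) : roundedWeight r = 0 ∨ ∃ z : ℤ, roundedWeight r = 2 ^ z := by
  rw [roundedWeight]
  split_ifs
  · exact Or.inl rfl
  · exact Or.inr ⟨_, rfl⟩

theorem roundedWeight_le {r : ℝ} (hr : 0 ≤ r) : roundedWeight r ≤ r := by
  rw [roundedWeight]
  split_ifs with h
  · exact hr
  · exact_mod_cast Int.zpow_log_le_self one_lt_two (lt_of_le_of_ne hr (Ne.symm h))

theorem le_two_mul_roundedWeight (r : ℝ) : r ≤ 2 * roundedWeight r := by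
  rw [roundedWeight]
  split_ifs with h
  · simp [h]
  · have := Int.lt_zpow_succ_log_self (b := 2) one_lt_two r
    rw [zpow_add_one₀ (by norm_num)] at this
    push_cast at this
    linarith

namespace Net

/-- The identifier of an edge. -/
def ident (X : Net) (e : X.Edge) : ℕ := pairCode (e.1.map X.N.id)

/-- The weight of an edge, rounded down to a power of two. -/
noncomputable def wt (X : Net) (e : X.Edge) : ℝ := roundedWeight (X.N.weight e.1)

theorem ident_injective (X : Net) : Function.Injective X.ident := fun _ _ h =>
  Subtype.ext (Sym2.map.injective X.N.id_injective (pairCode_injective h))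

variable {X : Net} {t : ℕ}

theorem localAt_ident : LocalAt X 1 Net.ident := by
  intro Y v v' p p' hv hp
  have h1 := (start_eq_of_view_eq hv).1
  have h2 := (start_eq_of_view_eq (nbr_eq_of_view_eq hv hp).1).1
  change pairCode s(_, _) = pairCode s(_, _)
  rw [h1, h2]

theorem localAt_wt : LocalAt X 0 Net.wt := fun _ _ _ p p' hv hp =>
  congrArg roundedWeight ((start_eq_of_view_eq hv).2.2.2 p p' hp)

theorem localAt_lowered (k n : ℕ) :
    LocalAt X (1 + n) fun Y e => lowered Y.nb k Y.ident n e := by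
  induction n with
  | zero => exact localAt_ident.map fun i => (startLevel k i, i)
  | succ n ih =>
    -- One round tests all candidate points simultaneously, via `LocalAt.pi`; choosing the least
    -- good one is local computation.
    have h1 : LocalAt X (1 + n + 1) fun Y e => loweringPoint Y.nb k (lowered Y.nb k Y.ident n) e :=
      ((ih.mono (Nat.le_succ _)).prod (LocalAt.pi fun x => ih.all fun a b =>
        ¬ LoweringClash k a b x)).map fun a =>
          sInf {x | x < levelPrime k (a.1.1 - 1) ∧ a.2 x}
    have h2 : (fun (Y : Net) e => lowered Y.nb k Y.ident (n + 1) e) = fun Y e =>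
        lowerStep Y.nb k (lowered Y.nb k Y.ident n) e := by
      funext Y e
      rw [lowered, Function.iterate_succ_apply', ← lowered]
    rw [h2]
    exact ((ih.mono (Nat.le_succ _)).prod h1).map fun a =>
      if a.1.1 = 0 then a.1 else (a.1.1 - 1, loweredColor k a.1 a.2)

theorem localAt_baseColor {k s : ℕ} (hs : ∀ e : X.Edge, startLevel k (X.ident e) ≤ s) :
    LocalAt X (1 + s) fun Y e => baseColor Y.nb k Y.ident e := by
  intro Y v v' p p' hv hp
  have h1 := localAt_lowered k s Y v v' p p' hv hp
  have h2 := (localAt_ident.mono (Nat.le_add_right 1 s)) Y v v' p p' hv hp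
  dsimp only at h1
  rw [lowered_eq (hs _), lowered_eq (h2 ▸ hs (X.edge v p))] at h1
  exact (Prod.mk.inj h1).2

theorem localAt_doubling (K s : ℕ) : LocalAt X s fun Y e => doubling Y.nb Y.wt K s e := by
  induction s with
  | zero => exact fun _ _ _ _ _ _ _ => rfl
  | succ s ih =>
    have h0 := (localAt_wt (X := X)).mono (Nat.zero_le s)
    have h1 := (h0.prod ih).sum fun a b => if b.1 = a.1 then b.2 else 0
    exact ((ih.mono (Nat.le_succ s)).prod h1).map fun a =>
      if a.1 + a.2 < 1 / 32 then 2 * a.1 else a.1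

section

variable {c : ∀ Y : Net, Y.Edge → ℕ} {x : ∀ Y : Net, Y.Edge → ℝ}

theorem localAt_hashColor (hc : LocalAt X t c) (hx : LocalAt X t x) (p d : ℕ) :
    LocalAt X (t + 1) fun Y e => hashColor Y.nb p d (pairCost Y.wt (x Y)) (c Y) e := by
  have hg := hc.prod (((localAt_wt (X := X)).mono (Nat.zero_le t)).prod hx)
  have h1 := hg.sum fun a b => min a.2.1 b.2.1 * (a.2.2 * b.2.2)
  have h2 : LocalAt X (t + 1) fun (Y : Net) (e : Y.Edge) (y : ℕ) => ∑ f ∈ Y.nb e,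
      if digitEval p d (c Y f) y = digitEval p d (c Y e) y then pairCost Y.wt (x Y) e f else 0 :=
    LocalAt.pi fun y => hg.sum fun a b =>
      if digitEval p d b.1 y = digitEval p d a.1 y then min a.2.1 b.2.1 * (a.2.2 * b.2.2) else 0
  have h3 : LocalAt X (t + 1) fun Y e => hashPoint Y.nb p d (pairCost Y.wt (x Y)) (c Y) e :=
    (h1.prod h2).map fun a => sInf {y | y < p ∧ a.2 y * p ≤ d * a.1}
  exact ((hc.mono (Nat.le_succ t)).prod h3).map fun a => a.2 * p + digitEval p d a.1 a.2

theorem localAt_slide (hc : LocalAt X t c) (hx : LocalAt X t x) (p d s : ℕ) :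
    LocalAt X (t + s) fun Y e => slide Y.nb p d (pairCost Y.wt (x Y)) (c Y) s e := by
  induction s with
  | zero => exact fun _ _ _ _ _ _ _ => rfl
  | succ s ih =>
    have hg := ((hc.prod (((localAt_wt (X := X)).mono (Nat.zero_le t)).prod hx)).mono
      (Nat.le_add_right t s)).prod ih
    have h1 := hg.sum fun a b => min a.1.2.1 b.1.2.1 * (a.1.2.2 * b.1.2.2)
    have h2 := hg.sum fun a b => if b.1.1 ≠ a.1.1 ∧
      b.2.getD (monicEval p d b.1.1 s) = monicEval p d a.1.1 s
      then min a.1.2.1 b.1.2.1 * (a.1.2.2 * b.1.2.2) else 0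
    exact ((hg.mono (Nat.le_succ _)).prod (h1.prod h2)).map fun a => a.1.2.orElse fun _ =>
      if a.2.2 * p ≤ (2 * d : ℕ) * a.2.1 then some (monicEval p d a.1.1.1 s) else none

theorem localAt_defectiveColor (hc : LocalAt X t c) (hx : LocalAt X t x) (k : ℕ) :
    LocalAt X (t + 1 + slidePrime k) fun Y e =>
      defectiveColor Y.nb k (pairCost Y.wt (x Y)) (c Y) e :=
  (localAt_slide (localAt_hashColor hc hx _ _) (hx.mono (Nat.le_succ t)) _ _ _).map
    fun a => a.getD 0

theorem localAt_sweep (hc : LocalAt X t c) (hx : LocalAt X t x) (μ r : ℝ) (s : ℕ) :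
    LocalAt X (t + s) fun Y e => sweep Y.nb Y.wt (c Y) μ r (x Y) s e := by
  induction s with
  | zero => exact hx
  | succ s ih =>
    have hg := ((hc.prod (((localAt_wt (X := X)).mono (Nat.zero_le t)).prod hx)).mono
      (Nat.le_add_right t s)).prod ih
    have h1 := hg.sum fun a b => if b.1.1 ≠ a.1.1 then min a.1.2.1 b.1.2.1 * b.2 else 0
    exact ((hg.mono (Nat.le_succ _)).prod h1).map fun a =>
      if a.1.1.1 = s ∧ a.1.1.2.2 = r then
        if 0 ≤ a.1.1.2.1 - μ * a.2 then 2 * r else 0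
      else a.1.2

/-- Each rounding step costs one round for hashing, `slidePrime k` for sliding and `slidePrime k`
for the sweep over the colors. -/
theorem localAt_roundAll (hc : LocalAt X t c) (k j : ℕ) {s : ℕ} (hs : t ≤ s)
    (hx : LocalAt X s x) :
    LocalAt X (s + j * (1 + 2 * slidePrime k)) fun Y e =>
      roundAll Y.nb k (c Y) Y.wt j (x Y) e := by
  induction j generalizing s x with
  | zero => exact hx.mono (Nat.le_add_right _ _)
  | succ j ih =>
    have h1 := localAt_defectiveColor (hc.mono hs) hx k
    have h2 := localAt_sweep h1 (hx.mono (by omega)) (1 + j / k) (2⁻¹ ^ (j + 1)) (slidePrime k)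
    have h3 := ih (s := s + 1 + slidePrime k + slidePrime k) (by omega) h2
    exact h3.mono (by rw [add_mul]; omega)

end

theorem localAt_selected {K s : ℕ} (hs : ∀ e : X.Edge, startLevel (K + 4) (X.ident e) ≤ s) :
    LocalAt X (1 + s + K + K * (1 + 2 * slidePrime (K + 4)) + 1) fun Y e =>
      Selected Y.nb K Y.ident Y.wt e := by
  have h1 := localAt_roundAll (X := X) (localAt_baseColor hs) (K + 4) K (s := 1 + s + K)
    (Nat.le_add_right _ _) ((localAt_doubling K K).mono (by omega))
  have h2 := (localAt_ident (X := X)).mono (show 1 ≤ 1 + s + K + K * (1 + 2 * slidePrime (K + 4)) by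
    omega)
  have hg := h1.prod (((localAt_wt (X := X)).mono (Nat.zero_le _)).prod h2)
  have h3 := hg.all fun a b => b.1 = 1 → b.2.1 < a.2.1 ∨ (b.2.1 = a.2.1 ∧ b.2.2 < a.2.2)
  exact ((h1.mono (Nat.le_succ _)).prod h3).map fun a => a.1 = 1 ∧ a.2

end Net

/-! ### The algorithm -/

/-- The ports of a node that lead to edges in `S`. -/
def Net.portSet (X : Net) (S : X.Edge → Prop) (v : X.V) : Set ℕ :=
  {q | ∃ h : q < X.deg v, S (X.edge v ⟨q, h⟩)}

open Classical in
/-- The output of a node if `S` is the set of chosen edges: the port of a chosen edge. -/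
noncomputable def Net.answer (X : Net) (S : X.Edge → Prop) (v : X.V) : Option ℕ :=
  if (X.portSet S v).Nonempty then some (sInf (X.portSet S v)) else none

open Classical in
/-- A node announces `o` as soon as its view proves that the answer given by `S` is `o`. -/
noncomputable def provenOutput (S : ∀ X : Net, X.Edge → Prop) (τ : View) : Option (Option ℕ) :=
  if h : ∃ o, (∀ (X : Net) t v, X.view t v = τ → X.answer (S X) v = o) then some h.choose else none

variable {S : ∀ X : Net, X.Edge → Prop}

theorem provenOutput_eq {X : Net} {t : ℕ} {v : X.V} {o : Option ℕ}
    (h : provenOutput S (X.view t v) = some o) : o = X.answer (S X) v := by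
  rw [provenOutput] at h
  split_ifs at h with h'
  rw [← Option.some.inj h, h'.choose_spec X t v rfl]

theorem provenOutput_of_localAt {X : Net} {T t : ℕ} (hS : LocalAt X T S) (ht : T ≤ t) (v : X.V) :
    provenOutput S (X.view t v) = some (X.answer (S X) v) := by
  have h : ∃ o, ∀ (Y : Net) t' v', Y.view t' v' = X.view t v → Y.answer (S Y) v' = o := by
    refine ⟨X.answer (S X) v, fun Y t' v' hv => ?_⟩
    -- A view records its own age, so it is only confused with views after the same number of
    -- rounds, to which `hS` applies.
    have htt : t' = t := by rw [← Y.depth_view t' v', hv, X.depth_view]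
    subst htt
    have hdeg := (Net.start_eq_of_view_eq hv).2.2.1
    have hset : Y.portSet (S Y) v' = X.portSet (S X) v := by
      ext q
      have key : ∀ h h', S X (X.edge v ⟨q, h⟩) = S Y (Y.edge v' ⟨q, h'⟩) := fun h h' =>
        hS Y v v' _ _ (Net.view_eq_of_le hv.symm ht) rfl
      exact ⟨fun ⟨h, hs⟩ => ⟨hdeg ▸ h, (key _ h).symm ▸ hs⟩,
        fun ⟨h, hs⟩ => ⟨hdeg.symm ▸ h, key h _ ▸ hs⟩⟩
    rw [Net.answer, Net.answer, hset]
  rw [provenOutput, dif_pos h]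
  exact congrArg some (h.choose_spec X t v rfl).symm

/-- The matching that consists of the edges in `S`. -/
def Net.subgraph (X : Net) (S : X.Edge → Prop) : X.G.Subgraph where
  verts := {v | ∃ p, S (X.edge v p)}
  Adj u v := ∃ h : X.G.Adj u v, S ⟨s(u, v), h⟩
  adj_sub h := h.1
  edge_vert := by
    rintro v w ⟨h, hs⟩
    obtain ⟨p, hp⟩ := Net.mem_edge (e := ⟨s(v, w), h⟩).1 (Sym2.mem_mk_left v w)
    exact ⟨p, hp ▸ hs⟩
  symm := ⟨fun u v ⟨h, hs⟩ => ⟨h.symm, by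
    have : (⟨s(v, u), h.symm⟩ : X.Edge) = ⟨s(u, v), h⟩ := Subtype.ext Sym2.eq_swap
    rwa [this]⟩⟩

theorem Net.mem_edgeSet_subgraph {X : Net} {S : X.Edge → Prop} (e : X.Edge) :
    e.1 ∈ (X.subgraph S).edgeSet ↔ S e := by
  obtain ⟨⟨a, b⟩, he⟩ := e
  exact ⟨fun h => h.2, fun h => ⟨he, h⟩⟩

theorem Net.subgraph_isMatching {X : Net} {S : X.Edge → Prop}
    (hS : ∀ e f, S e → S f → f ∉ X.nb e) : (X.subgraph S).IsMatching := by
  rintro v ⟨p, hp⟩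
  refine ⟨X.nbr v p, ⟨X.adj_nbr v p, hp⟩, fun u ⟨hu, hs⟩ => ?_⟩
  have h1 := hS _ _ hp hs
  rw [Net.mem_nb] at h1
  by_contra hne
  refine h1 ⟨fun h => hne ?_, v, Sym2.mem_mk_left _ _, Sym2.mem_mk_left _ _⟩
  exact Sym2.congr_right.1 (congrArg Subtype.val h)

theorem Net.answer_describes {X : Net} {S : X.Edge → Prop}
    (hS : ∀ e f, S e → S f → f ∉ X.nb e) :
    X.N.Describes (X.answer S) (X.subgraph S) := by
  intro v p
  have huniq : ∀ q q', S (X.edge v q) → S (X.edge v q') → q = q' := fun q q' h h' => by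
    by_contra hne
    exact hS _ _ h h' (Net.mem_nb.2 ⟨fun h => hne (X.edge_injective v h).symm, v,
      Sym2.mem_mk_left _ _, Sym2.mem_mk_left _ _⟩)
  have h1 : X.answer S v = some p ↔ ∃ h : p < X.deg v, S (X.edge v ⟨p, h⟩) := by
    rw [Net.answer]
    split_ifs with hex
    · obtain ⟨hlt, hs⟩ := Nat.sInf_mem hex
      rw [Option.some_inj]
      constructor
      · rintro rfl
        exact ⟨hlt, hs⟩
      · rintro ⟨hp, hs'⟩
        exact congrArg Fin.val (huniq _ _ hs hs')
    · simp only [false_iff]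
      exact fun h => hex ⟨p, h⟩
  rw [h1]
  constructor
  · rintro ⟨h, hs⟩
    refine ⟨(X.N.port v).symm ⟨p, h⟩, ⟨X.adj_nbr v ⟨p, h⟩, hs⟩, ?_⟩
    rw [Equiv.apply_symm_apply]
  · rintro ⟨u, ⟨hu, hs⟩, rfl⟩
    refine ⟨(X.N.port v u).2, ?_⟩
    have : X.edge v (X.N.port v u) = ⟨s(v, u), hu⟩ := Subtype.ext (by
      change s(v, ((X.N.port v).symm (X.N.port v u) : X.V)) = _
      rw [Equiv.symm_apply_apply])
    change S (X.edge v (X.N.port v u))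
    rwa [this]

/-! ### The selected edges against a maximum weighted matching -/

open Classical in
theorem Net.matchingWeight_eq (X : Net) (M : X.G.Subgraph) :
    matchingWeight X.N.weight M = ∑ e : X.Edge with e.1 ∈ M.edgeSet, X.N.weight e.1 := by
  rw [matchingWeight, finsum_mem_eq_finite_toFinset_sum _ (Set.toFinite _)]
  symm
  refine sum_bij (fun e _ => e.1) (fun e he => ?_) (fun a _ b _ h => Subtype.ext h)
    (fun e he => ?_) fun _ _ => rfl
  · simpa using he
  · rw [Set.Finite.mem_toFinset] at he
    exact ⟨⟨e, M.edgeSet_subset he⟩, by simpa using he, rfl⟩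

open Classical in
theorem Net.card_matching_nb_le (X : Net) {M : X.G.Subgraph} (hM : M.IsMatching) (e : X.Edge) :
    (((univ : Finset X.Edge).filter fun f => f.1 ∈ M.edgeSet).filter
      fun f => f = e ∨ f ∈ X.nb e).card ≤ 2 := by
  have hone : ∀ v : X.V,
      ((univ : Finset X.Edge).filter fun f => f.1 ∈ M.edgeSet ∧ v ∈ f.1).card ≤ 1 := by
    intro v
    refine card_le_one.2 fun f hf g hg => ?_
    rw [mem_filter] at hf hg
    obtain ⟨p, rfl⟩ := Net.mem_edge.1 hf.2.2
    obtain ⟨q, rfl⟩ := Net.mem_edge.1 hg.2.2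
    have h1 : M.Adj v (X.nbr v p) := hf.2.1
    have h2 : M.Adj v (X.nbr v q) := hg.2.1
    refine Subtype.ext (Sym2.congr_right.2 ((hM (M.edge_vert h1)).unique h1 h2))
  obtain ⟨v, p, rfl⟩ := Net.exists_edge_eq e
  refine (card_le_card fun f hf => ?_).trans
    ((card_union_le _ _).trans (add_le_add (hone v) (hone (X.nbr v p))))
  simp only [mem_filter, mem_univ, true_and, mem_union, Net.mem_nb] at hf ⊢
  rcases hf.2 with rfl | ⟨-, u, hu, huf⟩
  · exact Or.inl ⟨hf.1, Sym2.mem_mk_left _ _⟩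
  · rcases Sym2.mem_iff.1 hu with rfl | rfl
    · exact Or.inl ⟨hf.1, huf⟩
    · exact Or.inr ⟨hf.1, huf⟩

theorem Net.twoCliques (X : Net) {K : ℕ} (hK : 16 * X.G.maxDegree ≤ 2 ^ K) :
    TwoCliques X.nb K := by
  classical
  intro e
  obtain ⟨v, p, rfl⟩ := Net.exists_edge_eq e
  refine ⟨![univ.image (X.edge v), univ.image (X.edge (X.nbr v p))], fun f hf => ?_, ?_⟩
  · obtain ⟨-, u, hu, huf⟩ := Net.mem_nb.1 hf
    obtain ⟨q, rfl⟩ := Net.mem_edge.1 huf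
    rcases Sym2.mem_iff.1 hu with rfl | rfl
    · exact ⟨0, mem_image_of_mem _ (mem_univ q)⟩
    · exact ⟨1, mem_image_of_mem _ (mem_univ q)⟩
  · have key : ∀ u, 16 * (univ.image (X.edge u)).card ≤ 2 ^ K ∧ ∀ f ∈ univ.image (X.edge u),
        ∀ g ∈ univ.image (X.edge u), g ≠ f → g ∈ X.nb f := by
      intro u
      refine ⟨le_trans (Nat.mul_le_mul_left _ (card_image_le.trans ?_)) hK, fun f hf g hg hne => ?_⟩
      · rw [card_univ, Fintype.card_fin]
        exact X.G.degree_le_maxDegree u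
      · obtain ⟨q, -, rfl⟩ := mem_image.1 hf
        obtain ⟨r, -, rfl⟩ := mem_image.1 hg
        exact Net.mem_nb.2 ⟨hne, u, Sym2.mem_mk_left _ _, Sym2.mem_mk_left _ _⟩
    intro i
    fin_cases i
    · exact key v
    · exact key _

theorem Net.exists_isMaxWeightMatching (X : Net) :
    ∃ M : X.G.Subgraph, IsMaxWeightMatching X.N.weight M := by
  have hne : {M : X.G.Subgraph | M.IsMatching}.Nonempty := ⟨⊥, fun v hv => hv.elim⟩
  obtain ⟨M, hM, hmax⟩ := Set.exists_max_image _ (matchingWeight X.N.weight)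
    (Set.toFinite {M : X.G.Subgraph | M.IsMatching}) hne
  exact ⟨M, hM, hmax⟩

theorem Net.isApprox_selected (X : Net) {K : ℕ} (hK : 16 * X.G.maxDegree ≤ 2 ^ K) :
    IsApproxMaxWeightMatching 256 X.N.weight (X.subgraph (Selected X.nb K X.ident X.wt)) := by
  classical
  refine ⟨Net.subgraph_isMatching fun e f => Selected.not_mem Net.nb_symm, ?_⟩
  obtain ⟨M, hM⟩ := X.exists_isMaxWeightMatching
  refine ⟨M, hM, ?_⟩
  have h1 := sum_le_selected (nb := X.nb) Net.nb_symm Net.not_mem_nb X.ident_injective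
    (fun e => roundedWeight_eq (X.N.weight e.1)) (X.twoCliques hK)
    (M := univ.filter fun e => e.1 ∈ M.edgeSet)
    fun e => by convert X.card_matching_nb_le hM.1 e
  rw [X.matchingWeight_eq, X.matchingWeight_eq]
  simp only [Net.mem_edgeSet_subgraph]
  have h2 : ∑ e : X.Edge with e.1 ∈ M.edgeSet, X.N.weight e.1 ≤
      ∑ e : X.Edge with e.1 ∈ M.edgeSet, 2 * X.wt e :=
    sum_le_sum fun e _ => le_two_mul_roundedWeight _
  have h3 : ∑ e : X.Edge with Selected X.nb K X.ident X.wt e, X.wt e ≤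
      ∑ e : X.Edge with Selected X.nb K X.ident X.wt e, X.N.weight e.1 :=
    sum_le_sum fun e _ => roundedWeight_le (X.N.weight_nonneg _ e.2)
  rw [← mul_sum] at h2
  change ∑ e : X.Edge with e.1 ∈ M.edgeSet, X.wt e ≤ 128 * ∑ e : X.Edge with
    Selected X.nb K X.ident X.wt e, X.wt e at h1
  linarith

/-! ### The number of rounds -/

theorem iterate_logb_nonempty (x : ℝ) : {k : ℕ | (Real.logb 2)^[k] x ≤ 1}.Nonempty := by
  obtain ⟨n, hn⟩ := exists_nat_ge x
  induction n generalizing x with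
  | zero => exact ⟨0, hn.trans (by simp)⟩
  | succ n ih =>
    by_cases hx : x ≤ 1
    · exact ⟨0, hx⟩
    · have h1 : Real.logb 2 x ≤ n := by
        rw [Real.logb_le_iff_le_rpow one_lt_two (by linarith), Real.rpow_natCast]
        exact hn.trans (by exact_mod_cast Nat.lt_two_pow_self)
      obtain ⟨k, hk⟩ := ih _ h1
      exact ⟨k + 1, hk⟩

/-- Towers of twos undo iterated logarithms. Nonpositive `x`, where `Real.logb` is meaningless,
satisfy the bound trivially. -/
theorem le_levelBits_of_iterate {k j : ℕ} (hk : 1 ≤ k) {x : ℝ} (h : (Real.logb 2)^[j] x ≤ 1) :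
    x ≤ levelBits k j := by
  induction j generalizing x with
  | zero => exact h.trans (by exact_mod_cast hk)
  | succ j ih =>
    rcases le_or_gt x 0 with hx | hx
    · exact hx.trans (Nat.cast_nonneg _)
    · have h1 : Real.logb 2 x ≤ levelBits k j := ih h
      rw [Real.logb_le_iff_le_rpow one_lt_two hx, Real.rpow_natCast] at h1
      rw [levelBits]
      exact_mod_cast h1

theorem le_levelBits_logStar {k : ℕ} (hk : 1 ≤ k) (x : ℝ) : x ≤ levelBits k (logStar x) :=
  le_levelBits_of_iterate hk (Nat.sInf_mem (iterate_logb_nonempty x))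

theorem one_le_logStar {x : ℝ} (hx : 1 < x) : 1 ≤ logStar x := by
  by_contra! h
  have h1 : (Real.logb 2)^[logStar x] x ≤ 1 := Nat.sInf_mem (iterate_logb_nonempty x)
  rw [Nat.lt_one_iff.1 h] at h1
  exact hx.not_ge h1

theorem sq_le_two_pow {m : ℕ} (hm : 4 ≤ m) : m ^ 2 ≤ 2 ^ m := by
  induction m, hm using Nat.le_induction with
  | base => norm_num
  | succ m hm ih => rw [pow_succ 2 m]; nlinarith

/-- With `m = levelBits k (logStar n) ≥ n`, edge identifiers are below `2 ^ (2 * (m * a + 1))`.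
Since `a ≤ m` and `m ^ 2 ≤ 2 ^ m`, one further level of the tower accommodates them. -/
theorem startLevel_ident_le {X : Net} {a k : ℕ} (hk : a + 4 ≤ k)
    (hid : ∀ v, X.N.id v ≤ Fintype.card X.V ^ a) (e : X.Edge) :
    startLevel k (X.ident e) ≤ logStar (Fintype.card X.V) + 1 := by
  set n := Fintype.card X.V
  set m := levelBits k (logStar n) with hm
  have hn : n ≤ m := by exact_mod_cast le_levelBits_logStar (k := k) (by omega) (n : ℝ)
  have hkm : k ≤ m := start_le_levelBits k _
  refine startLevel_le ?_
  obtain ⟨v, p, rfl⟩ := Net.exists_edge_eq e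
  refine (pairCode_lt (hid v) (hid (X.nbr v p))).trans_le ?_
  have h1 : n ^ a + 1 ≤ 2 ^ (m * a + 1) := by
    have h2 : n ^ a ≤ 2 ^ (m * a) := by
      rw [pow_mul]
      exact Nat.pow_le_pow_left (hn.trans Nat.lt_two_pow_self.le) a
    have := Nat.one_le_two_pow (n := m * a)
    rw [pow_succ]
    omega
  refine (Nat.pow_le_pow_left h1 2).trans ?_
  rw [← pow_mul, palette, levelBits, ← hm]
  refine Nat.pow_le_pow_right two_pos ?_
  have h3 := sq_le_two_pow (m := m) (by omega)
  nlinarith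

theorem slidePrime_le {k : ℕ} (hk : 0 < k) : slidePrime k ≤ 512 * k :=
  (primeAbove_le (by omega)).trans (by omega)

/-- The parameter of the algorithm that is run when all nodes know `L`. -/
noncomputable def bitBound (a : ℕ) (κ L : ℝ) : ℕ := ⌈κ * L⌉₊ + a + 4

theorem sixteen_mul_le_two_pow_bitBound {a Δ : ℕ} {κ L : ℝ} (h : Real.logb 2 Δ ≤ κ * L) :
    16 * Δ ≤ 2 ^ bitBound a κ L := by
  have h1 : Δ ≤ 2 ^ ⌈κ * L⌉₊ := by
    rcases Nat.eq_zero_or_pos Δ with rfl | hΔ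
    · exact Nat.zero_le _
    · have h2 := h.trans (Nat.le_ceil _)
      rw [Real.logb_le_iff_le_rpow one_lt_two (by exact_mod_cast hΔ), Real.rpow_natCast] at h2
      exact_mod_cast h2
  calc 16 * Δ ≤ 2 ^ 4 * 2 ^ ⌈κ * L⌉₊ := Nat.mul_le_mul_left _ h1
    _ ≤ 2 ^ bitBound a κ L := by
      rw [← pow_add]
      exact Nat.pow_le_pow_right two_pos (by rw [bitBound]; omega)

/-- The edges chosen by the algorithm. -/
noncomputable def selection (a : ℕ) (κ : ℝ) (X : Net) : X.Edge → Prop :=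
  Selected X.nb (bitBound a κ X.L) X.ident X.wt

theorem localAt_selection {a : ℕ} {κ : ℝ} {X : Net} {s : ℕ}
    (hs : ∀ e : X.Edge, startLevel (bitBound a κ X.L + 4) (X.ident e) ≤ s) :
    LocalAt X (1 + s + bitBound a κ X.L +
      bitBound a κ X.L * (1 + 2 * slidePrime (bitBound a κ X.L + 4)) + 1) (selection a κ) := by
  intro Y v v' p p' hv hp
  have h := Net.localAt_selected hs Y v v' p p' hv hp
  -- The parameter depends on the network only through `L`, which is part of every view.
  rw [selection, selection, ← (Net.start_eq_of_view_eq hv).2.1]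
  exact h

theorem rounds_le {K s : ℕ} : 1 + (s + 1) + K + K * (1 + 2 * slidePrime (K + 4)) + 1 ≤
    1030 * (K + 4) ^ 2 + s := by
  have := Nat.mul_le_mul_left K (slidePrime_le (k := K + 4) (by omega))
  nlinarith

end DistMatching

/-- Identifiers are at most `n ^ a`, and every node knows a number `L` that equals `log Δ` up to
the constant factor `κ`; apart from this and its own local input no node knows anything in advance. -/
theorem mainTheorem8 (a : ℕ) (κ : ℝ) (hκ : 1 ≤ κ) :
    ∃ (A : DistMatching.LocalAlgorithm) (C : ℝ),
      ∀ (V : Type) [Fintype V] (G : SimpleGraph V) [DecidableRel G.Adj]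
        (N : DistMatching.Network G) (L : ℝ),
        (∀ v, N.id v ≤ Fintype.card V ^ a) →
        Real.logb 2 G.maxDegree ≤ κ * L →
        L ≤ κ * Real.logb 2 G.maxDegree →
        ∃ (T : ℕ) (y : V → Option ℕ) (M : G.Subgraph),
          (T : ℝ) ≤ C * (Real.logb 2 G.maxDegree ^ 2 + DistMatching.logStar (Fintype.card V)) ∧
          A.OutputsWithin N L T y ∧
          N.Describes y M ∧
          DistMatching.IsApproxMaxWeightMatching 256 N.weight M := by
  classical
  refine ⟨DistMatching.fullInformation (DistMatching.provenOutput (DistMatching.selection a κ)),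
    2060 * (κ ^ 2 + a + 9) ^ 2 + 1, fun V _ G _ N L hid hL hL' => ?_⟩
  let X : DistMatching.Net := ⟨V, inferInstance, G, inferInstance, N, L⟩
  have hloc : ∃ T : ℕ, (T : ℝ) ≤ (2060 * (κ ^ 2 + a + 9) ^ 2 + 1) *
      (Real.logb 2 G.maxDegree ^ 2 + DistMatching.logStar (Fintype.card V)) ∧
      DistMatching.LocalAt X T (DistMatching.selection a κ) := by
    rcases Nat.eq_zero_or_pos G.maxDegree with h0 | hpos
    -- Without edges, locality at time 0 is vacuous. The case is separate because the time bound may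
    -- be 0 here.
    · refine ⟨0, by simp only [Nat.cast_zero]; positivity, fun Y v v' p => ?_⟩
      have := p.2.trans_le (G.degree_le_maxDegree v)
      omega
    · refine ⟨_, ?_, DistMatching.localAt_selection (s := DistMatching.logStar
        (Fintype.card V) + 1) (DistMatching.startLevel_ident_le (X := X) (a := a) ?_ hid)⟩
      · refine (Nat.cast_le.2 DistMatching.rounds_le).trans ?_
        have hcard : (1 : ℝ) < Fintype.card V := by
          obtain ⟨v⟩ : Nonempty V := by
            by_contra hV
            rw [not_nonempty_iff] at hV
            simp at hpos
          have : Nonempty V := ⟨v⟩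
          exact_mod_cast (Nat.succ_le_of_lt hpos).trans_lt G.maxDegree_lt_card_verts
        -- An edge forces two nodes, so `log* n ≥ 1` absorbs additive constants, in particular the 1
        -- in `(l + 1) ^ 2` below.
        have hstar : (1 : ℝ) ≤ DistMatching.logStar (Fintype.card V) := by
          exact_mod_cast DistMatching.one_le_logStar hcard
        have hl : 0 ≤ Real.logb 2 G.maxDegree :=
          Real.logb_nonneg one_lt_two (by exact_mod_cast hpos)
        set l := Real.logb 2 (G.maxDegree : ℝ)
        -- The left side is `⌈κ * L⌉₊ + a + 8`, at most `κ ^ 2 * l + a + 9`. Squaring it, with 1030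
        -- from `rounds_le` and 2 from `h2`, gives the constant 2060.
        have hK : ((DistMatching.bitBound a κ L + 4 : ℕ) : ℝ) ≤ (κ ^ 2 + a + 9) * (l + 1) := by
          have h1 := (Nat.ceil_lt_add_one (hl.trans hL)).le
          have h2 : κ * L ≤ κ * (κ * l) := mul_le_mul_of_nonneg_left hL' (by linarith)
          have h3 : 0 ≤ (a + 9 : ℝ) * l := by positivity
          rw [DistMatching.bitBound]
          push_cast
          nlinarith [sq_nonneg κ]
        have h1 := pow_le_pow_left₀ (Nat.cast_nonneg _) hK 2
        have h2 : (l + 1) ^ 2 ≤ 2 * (l ^ 2 + DistMatching.logStar (Fintype.card V)) := by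
          nlinarith [sq_nonneg (l - 1)]
        have h3 := mul_le_mul_of_nonneg_left h2 (sq_nonneg (κ ^ 2 + a + 9))
        rw [mul_pow] at h1
        push_cast at h1 ⊢
        change 1030 * ((DistMatching.bitBound a κ L : ℝ) + 4) ^ 2 + _ ≤ _
        nlinarith [sq_nonneg l]
      · rw [DistMatching.bitBound]
        omega
  obtain ⟨T, hT, hS⟩ := hloc
  have hK : 16 * X.G.maxDegree ≤ 2 ^ DistMatching.bitBound a κ X.L :=
    DistMatching.sixteen_mul_le_two_pow_bitBound hL
  refine ⟨T, X.answer (DistMatching.selection a κ X),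
    X.subgraph (DistMatching.selection a κ X), hT, fun v => ⟨fun t ht => ?_, fun t o ho => ?_⟩,
    DistMatching.Net.answer_describes (X := X) fun e f => DistMatching.Selected.not_mem
      DistMatching.Net.nb_symm, X.isApprox_selected hK⟩
  · have := DistMatching.provenOutput_of_localAt hS ht v
    rwa [← X.run_fullInformation] at this
  · refine DistMatching.provenOutput_eq (X := X) (t := t) ?_
    rwa [← X.run_fullInformation]
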